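/- Let $\mathbb{H}$ be the upper half-plane and let $G = \{(M_1,M_2) \in \mathrm{SL}_2(\mathbb{Z})^2 : M_1 \equiv M_2 \pmod 2\}$. For a function $f$ on $\mathbb{H}\times\mathbb{H}$ put $$\Phi_1 f(\tau) = \lim_{z \to i\infty} f(z,\tau), \qquad \Phi_2 f(\tau) = \lim_{z\to i\infty} f(\tau,z).$$ A modular form of weight $k \ge 0$ for $G$ is a holomorphic function $f$ on $\mathbb{H}\times\mathbb{H}$ with $$f(M_1\cdot\tau_1, M_2\cdot\tau_2) = (c_1\tau_1+d_1)^k (c_2\tau_2+d_2)^k f(\tau_1,\tau_2)$$ for all $(M_1,M_2)\in G$, where $(c_i,d_i)$ is the bottom row of $M_i$, such that the limits $\Phi_1 f$ and $\Phi_2 f$ exist and are (holomorphic) modular forms of weight $k$ for $\Gamma_0(2)$. These forms make up the space $M_k(G)$ and the graded ring $M_*(G)=\bigoplus_{k\ge 0} M_k(G)$. Let $A_k \subseteq M_k(G)$ consist of the forms $f$ for which $\tau\mapsto\Phi_1 f(\tau/2)$ and $\tau\mapsto\Phi_2 f(\tau/2)$ are modular forms of weight $k$ for $\mathrm{SL}_2(\mathbb{Z})$,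 and let $A_k^{sym}\subseteq A_k$ consist of those that are symmetric, i.e. $f(\tau_1,\tau_2)=f(\tau_2,\tau_1)$; $f$ is antisymmetric if $f(\tau_1,\tau_2)=-f(\tau_2,\tau_1)$. Let $A_*=\bigoplus_k A_k$ and $A_*^{sym}=\bigoplus_k A_k^{sym}$, which are graded subrings of $M_*(G)$. Let $E_2(\tau)=1-24\sum_{n\ge1}\sigma_1(n)e^{2\pi i n\tau}$, $e_1(\tau)=2E_2(2\tau)-E_2(\tau)$, $e_2(\tau)=E_2(\tau)-\tfrac12E_2(\tau/2)$, $f_{ij}(\tau_1,\tau_2)=e_i(\tau_1)e_j(\tau_2)$, let $\eta$ be the Dedekind eta function, and let $$X_2=\tfrac43(f_{11}+f_{22})-\tfrac23(f_{12}+f_{21}),\quad X_4=\tfrac1{144}(f_{12}-f_{21})^2,\quad \Delta_6(\tau_1,\tau_2)=\eta(\tau_1)^{12}\eta(\tau_2)^{12},$$ $$X_8=\tfrac1{81}(f_{11}-f_{22})(f_{12}-f_{21})(f_{12}+f_{21}-f_{11})(f_{12}+f_{21}-f_{22}).$$ These are modular forms for $G$ of weights $2,4,6,8$. Then: (i) The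 $\mathbb{C}$-algebra $A_*^{sym}$ is generated by the five forms $$X_2^2-48X_4,\quad X_2^3-72X_2X_4,\quad \Delta_6,\quad X_2\Delta_6,\quad X_4\Delta_6,$$ which lie in $A_*^{sym}$ and have weights $4,6,6,8,10$. (ii) The $\mathbb{C}$-algebra $A_*$ is generated by these five forms together with $X_4X_8$, $\Delta_6X_8$ and $X_2\Delta_6X_8$, which are antisymmetric forms in $A_*$ of weights $12,14,16$. -/

import Mathlib

open scoped UpperHalfPlane MatrixGroups DirectSum Topology

noncomputable section

namespace DegHilbert

open UpperHalfPlane Filter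

/-- The group of all pairs `(M₁, M₂)` in `SL₂(ℤ) × SL₂(ℤ)` with `M₁ ≡ M₂` modulo `2`. -/
def G : Subgroup (SL(2, ℤ) × SL(2, ℤ)) :=
  MonoidHom.eqLocus
    ((Matrix.SpecialLinearGroup.map (n := Fin 2) (Int.castRingHom (ZMod 2))).comp
      (MonoidHom.fst SL(2, ℤ) SL(2, ℤ)))
    ((Matrix.SpecialLinearGroup.map (n := Fin 2) (Int.castRingHom (ZMod 2))).comp
      (MonoidHom.snd SL(2, ℤ) SL(2, ℤ)))

/-- `Γ₀(2)`, as a subgroup of `GL₂(ℝ)`. -/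
abbrev Gam : Subgroup (GL (Fin 2) ℝ) :=
  (CongruenceSubgroup.Gamma0 2).map (Matrix.SpecialLinearGroup.mapGL ℝ)

/-- `Φ₁ f (τ) = lim_{z → i∞} f (z, τ)` (only meaningful where the limit exists). -/
def Phi1 (f : ℍ × ℍ → ℂ) (τ : ℍ) : ℂ := limUnder atImInfty (fun z : ℍ => f (z, τ))

/-- `Φ₂ f (τ) = lim_{z → i∞} f (τ, z)` (only meaningful where the limit exists). -/
def Phi2 (f : ℍ × ℍ → ℂ) (τ : ℍ) : ℂ := limUnder atImInfty (fun z : ℍ => f (τ, z))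

/-- `f` is a modular form of weight `k` for `G`: it is holomorphic on `ℍ × ℍ`, it transforms with
the product of the two automorphy factors of weight `k`, the limits that define `Φ₁ f` and `Φ₂ f`
exist, and `Φ₁ f`, `Φ₂ f` are modular forms of weight `k` for `Γ₀(2)`. -/
structure IsModular (k : ℕ) (f : ℍ × ℍ → ℂ) : Prop where
  holo : DifferentiableOn ℂ (fun p : ℂ × ℂ => f (ofComplex p.1, ofComplex p.2))
    {p : ℂ × ℂ | 0 < p.1.im ∧ 0 < p.2.im}
  transf : ∀ M ∈ G, ∀ τ₁ τ₂ : ℍ, f (M.1 • τ₁, M.2 • τ₂) =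
    ((M.1 1 0 : ℂ) * (τ₁ : ℂ) + (M.1 1 1 : ℂ)) ^ k *
      ((M.2 1 0 : ℂ) * (τ₂ : ℂ) + (M.2 1 1 : ℂ)) ^ k * f (τ₁, τ₂)
  lim1 : ∀ τ : ℍ, Tendsto (fun z : ℍ => f (z, τ)) atImInfty (𝓝 (Phi1 f τ))
  lim2 : ∀ τ : ℍ, Tendsto (fun z : ℍ => f (τ, z)) atImInfty (𝓝 (Phi2 f τ))
  mod1 : ∃ g : ModularForm Gam (k : ℤ), (g : ℍ → ℂ) = Phi1 f
  mod2 : ∃ g : ModularForm Gam (k : ℤ), (g : ℍ → ℂ) = Phi2 f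

/-- `f (τ₁, τ₂) = f (τ₂, τ₁)`. -/
def IsSymm (f : ℍ × ℍ → ℂ) : Prop := ∀ τ₁ τ₂ : ℍ, f (τ₁, τ₂) = f (τ₂, τ₁)

/-- `f (τ₁, τ₂) = - f (τ₂, τ₁)`. -/
def IsAntisymm (f : ℍ × ℍ → ℂ) : Prop := ∀ τ₁ τ₂ : ℍ, f (τ₁, τ₂) = - f (τ₂, τ₁)

/-- The point `2τ`. -/
def dbl (τ : ℍ) : ℍ := (⟨2, two_pos⟩ : {x : ℝ // 0 < x}) • τ

/-- The point `τ/2`. -/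
def half (τ : ℍ) : ℍ := (⟨1 / 2, one_half_pos⟩ : {x : ℝ // 0 < x}) • τ

/-- `Φ₁ f (τ/2)` and `Φ₂ f (τ/2)` are modular forms of weight `k` for `SL₂(ℤ)`. -/
def HasLevelOneBoundary (k : ℕ) (f : ℍ × ℍ → ℂ) : Prop :=
  (∃ g : ModularForm 𝒮ℒ (k : ℤ), ∀ τ : ℍ, g τ = Phi1 f (half τ)) ∧
  (∃ g : ModularForm 𝒮ℒ (k : ℤ), ∀ τ : ℍ, g τ = Phi2 f (half τ))

/-! ### The graded pieces and the graded rings -/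

lemma Phi1_eq {f : ℍ × ℍ → ℂ} {τ : ℍ} {c : ℂ}
    (h : Tendsto (fun z : ℍ => f (z, τ)) atImInfty (𝓝 c)) : Phi1 f τ = c := h.limUnder_eq

lemma Phi2_eq {f : ℍ × ℍ → ℂ} {τ : ℍ} {c : ℂ}
    (h : Tendsto (fun z : ℍ => f (τ, z)) atImInfty (𝓝 c)) : Phi2 f τ = c := h.limUnder_eq

lemma Phi1_add {k : ℕ} {f g : ℍ × ℍ → ℂ} (hf : IsModular k f) (hg : IsModular k g) :
    Phi1 (f + g) = Phi1 f + Phi1 g :=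
  funext fun τ => Phi1_eq ((hf.lim1 τ).add (hg.lim1 τ))

lemma Phi2_add {k : ℕ} {f g : ℍ × ℍ → ℂ} (hf : IsModular k f) (hg : IsModular k g) :
    Phi2 (f + g) = Phi2 f + Phi2 g :=
  funext fun τ => Phi2_eq ((hf.lim2 τ).add (hg.lim2 τ))

lemma Phi1_mul {k l : ℕ} {f g : ℍ × ℍ → ℂ} (hf : IsModular k f) (hg : IsModular l g) :
    Phi1 (f * g) = Phi1 f * Phi1 g :=
  funext fun τ => Phi1_eq ((hf.lim1 τ).mul (hg.lim1 τ))

lemma Phi2_mul {k l : ℕ} {f g : ℍ × ℍ → ℂ} (hf : IsModular k f) (hg : IsModular l g) :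
    Phi2 (f * g) = Phi2 f * Phi2 g :=
  funext fun τ => Phi2_eq ((hf.lim2 τ).mul (hg.lim2 τ))

lemma Phi1_smul {k : ℕ} (c : ℂ) {f : ℍ × ℍ → ℂ} (hf : IsModular k f) :
    Phi1 (c • f) = c • Phi1 f :=
  funext fun τ => Phi1_eq ((hf.lim1 τ).const_smul c)

lemma Phi2_smul {k : ℕ} (c : ℂ) {f : ℍ × ℍ → ℂ} (hf : IsModular k f) :
    Phi2 (c • f) = c • Phi2 f :=
  funext fun τ => Phi2_eq ((hf.lim2 τ).const_smul c)

lemma Phi1_const (c : ℂ) : Phi1 (fun _ => c) = fun _ => c :=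
  funext fun _ => Phi1_eq tendsto_const_nhds

lemma Phi2_const (c : ℂ) : Phi2 (fun _ => c) = fun _ => c :=
  funext fun _ => Phi2_eq tendsto_const_nhds

lemma IsModular.add {k : ℕ} {f g : ℍ × ℍ → ℂ} (hf : IsModular k f) (hg : IsModular k g) :
    IsModular k (f + g) where
  holo := hf.holo.add hg.holo
  transf M hM τ₁ τ₂ := by
    simp only [Pi.add_apply, hf.transf M hM, hg.transf M hM]; ring
  lim1 τ := by
    rw [Phi1_add hf hg]; exact (hf.lim1 τ).add (hg.lim1 τ)
  lim2 τ := by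
    rw [Phi2_add hf hg]; exact (hf.lim2 τ).add (hg.lim2 τ)
  mod1 := by
    obtain ⟨a, ha⟩ := hf.mod1
    obtain ⟨b, hb⟩ := hg.mod1
    exact ⟨a + b, by rw [Phi1_add hf hg, ← ha, ← hb]; rfl⟩
  mod2 := by
    obtain ⟨a, ha⟩ := hf.mod2
    obtain ⟨b, hb⟩ := hg.mod2
    exact ⟨a + b, by rw [Phi2_add hf hg, ← ha, ← hb]; rfl⟩

lemma IsModular.smul {k : ℕ} (c : ℂ) {f : ℍ × ℍ → ℂ} (hf : IsModular k f) :
    IsModular k (c • f) where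
  holo := hf.holo.const_smul c
  transf M hM τ₁ τ₂ := by
    simp only [Pi.smul_apply, smul_eq_mul, hf.transf M hM]; ring
  lim1 τ := by
    rw [Phi1_smul c hf]; exact (hf.lim1 τ).const_smul c
  lim2 τ := by
    rw [Phi2_smul c hf]; exact (hf.lim2 τ).const_smul c
  mod1 := by
    obtain ⟨a, ha⟩ := hf.mod1
    exact ⟨c • a, by rw [Phi1_smul c hf, ← ha]; rfl⟩
  mod2 := by
    obtain ⟨a, ha⟩ := hf.mod2
    exact ⟨c • a, by rw [Phi2_smul c hf, ← ha]; rfl⟩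

lemma IsModular.zero (k : ℕ) : IsModular k (0 : ℍ × ℍ → ℂ) where
  holo := differentiableOn_const 0
  transf M hM τ₁ τ₂ := by simp
  lim1 τ := by
    rw [show Phi1 0 = fun _ => 0 from Phi1_const 0]; exact tendsto_const_nhds
  lim2 τ := by
    rw [show Phi2 0 = fun _ => 0 from Phi2_const 0]; exact tendsto_const_nhds
  mod1 := ⟨0, (Phi1_const 0).symm⟩
  mod2 := ⟨0, (Phi2_const 0).symm⟩

lemma IsModular.one : IsModular 0 (1 : ℍ × ℍ → ℂ) where
  holo := differentiableOn_const 1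
  transf M hM τ₁ τ₂ := by simp
  lim1 τ := by
    rw [show Phi1 1 = fun _ => 1 from Phi1_const 1]; exact tendsto_const_nhds
  lim2 τ := by
    rw [show Phi2 1 = fun _ => 1 from Phi2_const 1]; exact tendsto_const_nhds
  mod1 := ⟨(1 : ModularForm Gam 0), (Phi1_const 1).symm⟩
  mod2 := ⟨(1 : ModularForm Gam 0), (Phi2_const 1).symm⟩

lemma IsModular.mul {k l : ℕ} {f g : ℍ × ℍ → ℂ} (hf : IsModular k f) (hg : IsModular l g) :
    IsModular (k + l) (f * g) where
  holo := hf.holo.mul hg.holo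
  transf M hM τ₁ τ₂ := by
    simp only [Pi.mul_apply, hf.transf M hM, hg.transf M hM]; ring
  lim1 τ := by
    rw [Phi1_mul hf hg]; exact (hf.lim1 τ).mul (hg.lim1 τ)
  lim2 τ := by
    rw [Phi2_mul hf hg]; exact (hf.lim2 τ).mul (hg.lim2 τ)
  mod1 := by
    obtain ⟨a, ha⟩ := hf.mod1
    obtain ⟨b, hb⟩ := hg.mod1
    exact ⟨ModularForm.mcast (Nat.cast_add k l).symm (a.mul b), by
      rw [Phi1_mul hf hg, ← ha, ← hb]; rfl⟩
  mod2 := by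
    obtain ⟨a, ha⟩ := hf.mod2
    obtain ⟨b, hb⟩ := hg.mod2
    exact ⟨ModularForm.mcast (Nat.cast_add k l).symm (a.mul b), by
      rw [Phi2_mul hf hg, ← ha, ← hb]; rfl⟩

/-- `M_k(G)`. -/
def M (k : ℕ) : Submodule ℂ (ℍ × ℍ → ℂ) where
  carrier := {f | IsModular k f}
  add_mem' hf hg := IsModular.add hf hg
  zero_mem' := IsModular.zero k
  smul_mem' c _ hf := IsModular.smul c hf

instance : SetLike.GradedMonoid M where
  one_mem := IsModular.one
  mul_mem _ _ _ _ hf hg := IsModular.mul hf hg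

/-- `M_*(G) = ⨁_{k ≥ 0} M_k(G)`, a graded commutative `ℂ`-algebra. -/
abbrev MRing : Type := ⨁ k : ℕ, M k

/-- `A_k`: the `f` in `M_k(G)` for which `Φ₁ f (τ/2)` and `Φ₂ f (τ/2)` have level one. -/
def A (k : ℕ) : Submodule ℂ (ℍ × ℍ → ℂ) where
  carrier := {f | IsModular k f ∧ HasLevelOneBoundary k f}
  add_mem' := by
    rintro f g ⟨hf, ⟨a, ha⟩, ⟨b, hb⟩⟩ ⟨hg, ⟨c, hc⟩, ⟨d, hd⟩⟩
    refine ⟨hf.add hg, ⟨a + c, fun τ => ?_⟩, ⟨b + d, fun τ => ?_⟩⟩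
    · rw [Phi1_add hf hg, Pi.add_apply, ← ha, ← hc]; rfl
    · rw [Phi2_add hf hg, Pi.add_apply, ← hb, ← hd]; rfl
  zero_mem' := by
    refine ⟨IsModular.zero k, ⟨0, fun τ => ?_⟩, ⟨0, fun τ => ?_⟩⟩
    · exact (congrFun (Phi1_const 0) (half τ)).symm
    · exact (congrFun (Phi2_const 0) (half τ)).symm
  smul_mem' := by
    rintro c f ⟨hf, ⟨a, ha⟩, ⟨b, hb⟩⟩
    refine ⟨hf.smul c, ⟨c • a, fun τ => ?_⟩, ⟨c • b, fun τ => ?_⟩⟩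
    · rw [Phi1_smul c hf, Pi.smul_apply, ← ha]; rfl
    · rw [Phi2_smul c hf, Pi.smul_apply, ← hb]; rfl

instance : SetLike.GradedMonoid A where
  one_mem := by
    refine ⟨IsModular.one, ⟨(1 : ModularForm 𝒮ℒ 0), fun τ => ?_⟩,
      ⟨(1 : ModularForm 𝒮ℒ 0), fun τ => ?_⟩⟩
    · exact (congrFun (Phi1_const 1) (half τ)).symm
    · exact (congrFun (Phi2_const 1) (half τ)).symm
  mul_mem := by
    rintro k l f g ⟨hf, ⟨a, ha⟩, ⟨b, hb⟩⟩ ⟨hg, ⟨c, hc⟩, ⟨d, hd⟩⟩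
    refine ⟨hf.mul hg, ⟨ModularForm.mcast (Nat.cast_add k l).symm (a.mul c), fun τ => ?_⟩,
      ⟨ModularForm.mcast (Nat.cast_add k l).symm (b.mul d), fun τ => ?_⟩⟩
    · rw [Phi1_mul hf hg, Pi.mul_apply, ← ha, ← hc]; rfl
    · rw [Phi2_mul hf hg, Pi.mul_apply, ← hb, ← hd]; rfl

/-- `A_k^sym`: the symmetric forms in `A_k`. -/
def Asym (k : ℕ) : Submodule ℂ (ℍ × ℍ → ℂ) where
  carrier := {f | f ∈ A k ∧ IsSymm f}
  add_mem' := by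
    rintro f g ⟨hf, sf⟩ ⟨hg, sg⟩
    exact ⟨add_mem hf hg, fun τ₁ τ₂ => by simp only [Pi.add_apply, sf τ₁ τ₂, sg τ₁ τ₂]⟩
  zero_mem' := ⟨zero_mem _, fun _ _ => rfl⟩
  smul_mem' := by
    rintro c f ⟨hf, sf⟩
    exact ⟨Submodule.smul_mem _ c hf, fun τ₁ τ₂ => by simp only [Pi.smul_apply, sf τ₁ τ₂]⟩

instance : SetLike.GradedMonoid Asym where
  one_mem := ⟨SetLike.GradedOne.one_mem, fun _ _ => rfl⟩
  mul_mem := by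
    rintro k l f g ⟨hf, sf⟩ ⟨hg, sg⟩
    exact ⟨SetLike.GradedMul.mul_mem hf hg,
      fun τ₁ τ₂ => by simp only [Pi.mul_apply, sf τ₁ τ₂, sg τ₁ τ₂]⟩

/-- The subalgebra of `M_*(G)` of those elements whose component of each weight `k` lies in `N k`,
for a multiplicatively closed family of spaces `N k`. -/
def gradedSub (N : ℕ → Submodule ℂ (ℍ × ℍ → ℂ)) [SetLike.GradedMonoid N] :
    Subalgebra ℂ MRing where
  carrier := {x | ∀ k, (x k : ℍ × ℍ → ℂ) ∈ N k}
  add_mem' {x y} hx hy k := by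
    rw [DirectSum.add_apply, Submodule.coe_add]; exact add_mem (hx k) (hy k)
  mul_mem' {x y} hx hy k := by
    classical
    rw [DirectSum.coe_mul_apply M x y k]
    refine sum_mem fun ij hij => ?_
    rw [← (Finset.mem_filter.1 hij).2]
    exact SetLike.GradedMul.mul_mem (hx _) (hy _)
  algebraMap_mem' c k := by
    classical
    rw [Algebra.algebraMap_eq_smul_one, DirectSum.smul_apply, Submodule.coe_smul]
    refine Submodule.smul_mem _ c ?_
    rw [DirectSum.one_def, DirectSum.coe_of_apply]
    split_ifs with h
    · subst h; exact SetLike.GradedOne.one_mem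
    · exact zero_mem _

/-- The graded subring `A_*` of `M_*(G)`. -/
def ARing : Subalgebra ℂ MRing := gradedSub A

/-- The graded subring `A_*^sym` of `M_*(G)`. -/
def AsymRing : Subalgebra ℂ MRing := gradedSub Asym

/-! ### The special forms -/

/-- `e₁(τ) = 2 E₂(2τ) - E₂(τ)`, where `E₂ = 1 - 24 ∑ σ₁(n) qⁿ`. -/
def e1 (τ : ℍ) : ℂ := 2 * EisensteinSeries.E2 (dbl τ) - EisensteinSeries.E2 τ

/-- `e₂(τ) = E₂(τ) - E₂(τ/2) / 2`. -/
def e2 (τ : ℍ) : ℂ := EisensteinSeries.E2 τ - 1 / 2 * EisensteinSeries.E2 (half τ)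

/-- `f₁₁(τ₁, τ₂) = e₁(τ₁) e₁(τ₂)`. -/
def f11 (p : ℍ × ℍ) : ℂ := e1 p.1 * e1 p.2

/-- `f₁₂(τ₁, τ₂) = e₁(τ₁) e₂(τ₂)`. -/
def f12 (p : ℍ × ℍ) : ℂ := e1 p.1 * e2 p.2

/-- `f₂₁(τ₁, τ₂) = e₂(τ₁) e₁(τ₂)`. -/
def f21 (p : ℍ × ℍ) : ℂ := e2 p.1 * e1 p.2

/-- `f₂₂(τ₁, τ₂) = e₂(τ₁) e₂(τ₂)`. -/
def f22 (p : ℍ × ℍ) : ℂ := e2 p.1 * e2 p.2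

/-- The form `X₂`. -/
def X2 : ℍ × ℍ → ℂ := (4 / 3 : ℂ) • (f11 + f22) - (2 / 3 : ℂ) • (f12 + f21)

/-- The form `X₄`. -/
def X4 : ℍ × ℍ → ℂ := (1 / 144 : ℂ) • (f12 - f21) ^ 2

/-- The form `Δ₆(τ₁, τ₂) = η(τ₁)¹² η(τ₂)¹²`. -/
def Delta6 (p : ℍ × ℍ) : ℂ := ModularForm.eta p.1 ^ 12 * ModularForm.eta p.2 ^ 12

/-- The form `X₈`. -/
def X8 : ℍ × ℍ → ℂ :=
  (1 / 81 : ℂ) • ((f11 - f22) * (f12 - f21) * (f12 + f21 - f11) * (f12 + f21 - f22))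

/-- A form of weight `k`, as a homogeneous element of degree `k` of `M_*(G)`. -/
def hom (k : ℕ) (f : ℍ × ℍ → ℂ) (hf : f ∈ M k) : MRing := DirectSum.of (fun k => M k) k ⟨f, hf⟩

end DegHilbert

end

/-!
The proof is a descent on the weight, by division by forms without zeros on the upper half-plane.

Put `wInf = 2 e₂ - e₁`, `wZero = 2 e₁ - e₂`, `wOne = e₁ + e₂`. These forms of weight two for `Γ(2)`
have no zeros on `ℍ`, and each vanishes at exactly one of the three cusps `i∞`, `0`, `1`: the square
of their product is a form of level one and weight twelve that vanishes at `i∞`, hence a multiple of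
the discriminant, so the product is a multiple of `η¹²` (`wProd_eq`). Therefore a form of level two
that vanishes at all cusps is divisible by `η¹²` (`div_eta12_mem`), and one that vanishes at `i∞` is
divisible by `wInf` (`exists_wInf_mul`). The latter gives the structure of the forms for `Γ₀(2)`:
they are the polynomials in `e₁ = Φ₁ X₂` and `wInf² = 576 Φ₁ X₄` (`exists_phi1_eq`).

A form `f` for `G` restricts to a form of level two in each variable, and `(γ, γ) ∈ G` relates the
cusps of a restriction to `i∞`, so if `Φ₁ f = Φ₂ f = 0` then `f` is divisible by `Δ₆`
(`IsModular.exists_Delta6_mul`). By induction on the weight every symmetric form is a polynomial in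
`X₂`, `X₄`, `Δ₆` (`symm_mem_homog`).

If `f` is antisymmetric then `Φ₁ f` vanishes at every cusp (`IsAntisymm.tendsto_phi1_slash`). This
comes from the fact that the two iterated limits at `(i∞, i∞)` agree, because on the finite
dimensional space of forms of level two the value at `i∞` is a linear combination of point
evaluations (`exists_valueAtInfty_eq_sum`). Hence `Φ₁ f` is divisible by
`wInf η¹²`, that is, by `wInf² wZero wOne = 1296 Φ₁ X₈`, and induction shows that every
antisymmetric form is `X₈` times a polynomial in `X₂`, `X₄`, `Δ₆` (`antisymm_eq_X8_mul`).

For the ring `A_*`, the forms `g4 = X₂² - 48 X₄` and `g6 = X₂³ - 72 X₂ X₄` have the boundary values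
`E₄(2τ)` and `E₆(2τ)`, and `1728 X₄ X₈` has the boundary value `E₄(2τ)³ - E₆(2τ)²`. As `E₄` and `E₆`
generate the forms of level one, a symmetric form of `A_*` agrees on the boundary with a polynomial
in `g4`, `g6`, and an antisymmetric one, whose boundary value is a cusp form, with `X₄ X₈` times such
a polynomial. The difference is a polynomial in `X₂`, `X₄`, `Δ₆` times `Δ₆`, respectively `Δ₆ X₈`. It
lies in the algebra of the given generators because `1`, `X₂`, `X₄` generate `ℂ[X₂, X₄]` as a module
over `ℂ[g4, g6]` (`mul_mem_of_mem_adjoin`).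
-/

noncomputable section

namespace DegHilbert

open UpperHalfPlane Filter
open scoped Manifold ModularForm
open CongruenceSubgroup ModularGroup
open EisensteinSeries (E2)

/-! ### Spaces of modular forms as spaces of functions -/

/-- The space of modular forms of weight `k` for a subgroup `Γ` of `SL₂(ℤ)`, as a space of
functions: holomorphic, `Γ`-invariant, and bounded at `i∞` after any slash by `SL₂(ℤ)`. -/
def forms (Γ : Subgroup SL(2, ℤ)) (k : ℤ) : Submodule ℂ (ℍ → ℂ) where
  carrier := {f | MDiff f ∧ (∀ γ ∈ Γ, f ∣[k] γ = f) ∧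
    ∀ γ : SL(2, ℤ), IsBoundedAtImInfty (f ∣[k] γ)}
  add_mem' := by
    rintro f g ⟨hf, hf', hf''⟩ ⟨hg, hg', hg''⟩
    refine ⟨hf.add hg, fun γ hγ => ?_, fun γ => ?_⟩
    · rw [SlashAction.add_slash, hf' γ hγ, hg' γ hγ]
    · rw [SlashAction.add_slash]; exact (hf'' γ).add (hg'' γ)
  zero_mem' := by
    refine ⟨mdifferentiable_const, fun γ _ => SlashAction.zero_slash _ _, fun γ => ?_⟩
    rw [SlashAction.zero_slash]; exact zero_form_isBoundedAtImInfty
  smul_mem' := by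
    rintro c f ⟨hf, hf', hf''⟩
    refine ⟨hf.const_smul c, fun γ hγ => ?_, fun γ => ?_⟩
    · rw [ModularForm.SL_smul_slash, hf' γ hγ]
    · rw [ModularForm.SL_smul_slash]
      exact (hf'' γ).const_smul_left c

lemma forms_mono {Γ Γ' : Subgroup SL(2, ℤ)} (h : Γ ≤ Γ') (k : ℤ) : forms Γ' k ≤ forms Γ k :=
  fun _ hf => ⟨hf.1, fun γ hγ => hf.2.1 γ (h hγ), hf.2.2⟩

lemma mul_mem_forms {Γ : Subgroup SL(2, ℤ)} {k l : ℤ} {f g : ℍ → ℂ} (hf : f ∈ forms Γ k)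
    (hg : g ∈ forms Γ l) : f * g ∈ forms Γ (k + l) := by
  refine ⟨hf.1.mul hg.1, fun γ hγ => ?_, fun γ => ?_⟩
  · rw [ModularForm.mul_slash_SL2, hf.2.1 γ hγ, hg.2.1 γ hγ]
  · rw [ModularForm.mul_slash_SL2]; exact (hf.2.2 γ).mul (hg.2.2 γ)

lemma const_mem_forms (Γ : Subgroup SL(2, ℤ)) (c : ℂ) : (fun _ => c) ∈ forms Γ 0 := by
  have h (γ : SL(2, ℤ)) : (fun _ => c) ∣[(0 : ℤ)] γ = fun _ => c :=
    ModularForm.is_invariant_const γ c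
  refine ⟨mdifferentiable_const, fun γ _ => h γ, fun γ => ?_⟩
  rw [h]; exact atImInfty.const_boundedAtFilter c

lemma pow_mem_forms {Γ : Subgroup SL(2, ℤ)} {k : ℤ} {f : ℍ → ℂ} (hf : f ∈ forms Γ k) (n : ℕ) :
    f ^ n ∈ forms Γ (n * k) := by
  induction n with
  | zero => simpa using! const_mem_forms Γ 1
  | succ n ih =>
    rw [pow_succ, show ((n + 1 : ℕ) : ℤ) * k = n * k + k by push_cast; ring]
    exact mul_mem_forms ih hf

lemma slash_mem_forms {Γ : Subgroup SL(2, ℤ)} [hΓ : Γ.Normal] {k : ℤ} {f : ℍ → ℂ}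
    (hf : f ∈ forms Γ k) (γ : SL(2, ℤ)) : f ∣[k] γ ∈ forms Γ k := by
  refine ⟨hf.1.slash k _, fun δ hδ => ?_, fun δ => ?_⟩
  · rw [← SlashAction.slash_mul, show γ * δ = (γ * δ * γ⁻¹) * γ by group, SlashAction.slash_mul,
      hf.2.1 _ (hΓ.conj_mem δ hδ γ)]
  · rw [← SlashAction.slash_mul]; exact hf.2.2 _

/-- The functions in `forms Γ k` are the underlying functions of modular forms. -/
lemma mem_forms_iff {Γ : Subgroup SL(2, ℤ)} [Γ.FiniteIndex] {k : ℤ} {f : ℍ → ℂ} :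
    f ∈ forms Γ k ↔
      ∃ g : ModularForm (Γ.map (Matrix.SpecialLinearGroup.mapGL ℝ)) k, (g : ℍ → ℂ) = f := by
  constructor
  · intro hf
    refine ⟨{ toFun := f, slash_action_eq' := ?_, holo' := hf.1, bdd_at_cusps' := ?_ }, rfl⟩
    · rintro _ ⟨γ, hγ, rfl⟩; exact hf.2.1 γ hγ
    · intro c hc
      rw [Subgroup.IsArithmetic.isCusp_iff_isCusp_SL2Z] at hc
      rw [OnePoint.isBoundedAt_iff_forall_SL2Z hc]
      exact fun γ _ => hf.2.2 γ
  · rintro ⟨g, rfl⟩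
    refine ⟨g.holo', fun γ hγ => g.slash_action_eq' _ ⟨γ, hγ, rfl⟩, fun γ => ?_⟩
    refine g.bdd_at_cusps' (c := Matrix.SpecialLinearGroup.mapGL ℝ γ • OnePoint.infty) ?_ _ rfl
    rw [Subgroup.IsArithmetic.isCusp_iff_isCusp_SL2Z, isCusp_SL2Z_iff']
    exact ⟨γ, rfl⟩

lemma mem_forms_top_iff {k : ℤ} {f : ℍ → ℂ} :
    f ∈ forms ⊤ k ↔ ∃ g : ModularForm 𝒮ℒ k, (g : ℍ → ℂ) = f := by
  rw [mem_forms_iff, ← MonoidHom.range_eq_map]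

lemma forms_eq_zero_of_neg {Γ : Subgroup SL(2, ℤ)} [Γ.FiniteIndex] {k : ℤ} (hk : k < 0)
    {f : ℍ → ℂ} (hf : f ∈ forms Γ k) : f = 0 := by
  obtain ⟨g, rfl⟩ := mem_forms_iff.1 hf
  rw [ModularForm.isZero_of_neg_weight hk g]; rfl

/-- When `-1 ∈ Γ`, it forces a form of odd weight to be its own negative. -/
lemma forms_eq_zero_of_odd {Γ : Subgroup SL(2, ℤ)} (hΓ : -1 ∈ Γ) {k : ℤ} (hk : Odd k)
    {f : ℍ → ℂ} (hf : f ∈ forms Γ k) : f = 0 := by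
  ext z
  have := congrFun (hf.2.1 _ hΓ) z
  rw [ModularForm.slash_action_eq'_iff] at this
  simp [hk.neg_one_zpow] at this
  simpa [self_eq_neg] using this

lemma neg_one_mem_Gamma_two : (-1 : SL(2, ℤ)) ∈ Gamma 2 := by
  rw [Gamma_mem]; simp

lemma T_sq_mem_Gamma_two : T ^ 2 ∈ Gamma 2 := by
  rw [Gamma_mem]; simp [ModularGroup.T]; decide

instance : (Gamma 2).Normal := Gamma_normal 2

lemma slash_T_apply (f : ℍ → ℂ) (k : ℤ) (z : ℍ) : (f ∣[k] T) z = f ((1 : ℝ) +ᵥ z) := by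
  rw [ModularForm.SL_slash_apply, ModularGroup.denom_apply, modular_T_smul]; simp [ModularGroup.T]

lemma periodic_of_mem_forms {k : ℤ} {f : ℍ → ℂ} (hf : f ∈ forms (Gamma 2) k) :
    Function.Periodic (f ∘ ofComplex) (2 : ℝ) := by
  obtain ⟨g, rfl⟩ := mem_forms_iff.1 hf
  refine SlashInvariantFormClass.periodic_comp_ofComplex g ?_
  simp

lemma bounded_of_mem_forms {Γ : Subgroup SL(2, ℤ)} {k : ℤ} {f : ℍ → ℂ} (hf : f ∈ forms Γ k) :
    IsBoundedAtImInfty f := by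
  simpa using hf.2.2 1

lemma tendsto_valueAtInfty {h : ℝ} (hh : 0 < h) {f : ℍ → ℂ}
    (hper : Function.Periodic (f ∘ ofComplex) h) (hf : MDiff f) (hbdd : IsBoundedAtImInfty f) :
    Tendsto f atImInfty (𝓝 (valueAtInfty f)) := by
  have h1 := exp_decay_sub_atImInfty hh hper hf hbdd
  have h0 : Tendsto (fun τ : ℍ => Real.exp (-2 * Real.pi * τ.im / h)) atImInfty (𝓝 0) := by
    refine Real.tendsto_exp_atBot.comp ?_
    have : Tendsto (fun τ : ℍ => τ.im) atImInfty atTop := tendsto_comap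
    refine (this.const_mul_atTop_of_neg (r := -2 * Real.pi / h) ?_).congr ?_
    · exact div_neg_of_neg_of_pos (by linarith [Real.pi_pos]) hh
    · intro τ; ring
  simpa using (h1.trans_tendsto h0).add_const (valueAtInfty f)

lemma tendsto_of_mem_forms {k : ℤ} {f : ℍ → ℂ} (hf : f ∈ forms (Gamma 2) k) :
    Tendsto f atImInfty (𝓝 (valueAtInfty f)) :=
  tendsto_valueAtInfty two_pos (periodic_of_mem_forms hf) hf.1 (bounded_of_mem_forms hf)

/-! ### The Eisenstein series `e₁` and `e₂` -/

lemma periodic_of_slash_T {f : ℍ → ℂ} {k : ℤ} (hf : f ∣[k] T = f) :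
    Function.Periodic (f ∘ ofComplex) (1 : ℝ) := by
  intro w
  by_cases hw : 0 < w.im
  · have hw' : 0 < (w + (1 : ℝ)).im := by simpa using hw
    rw [Function.comp_apply, Function.comp_apply, ofComplex_apply_of_im_pos hw,
      ofComplex_apply_of_im_pos hw', ← congrFun hf ⟨w, hw⟩, slash_T_apply]
    congr 1
    ext; simp [add_comm]
  · have hw' : (w + (1 : ℝ)).im ≤ 0 := by simpa using hw
    rw [Function.comp_apply, Function.comp_apply, ofComplex_apply_of_im_nonpos (not_lt.1 hw),
      ofComplex_apply_of_im_nonpos hw']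

lemma E2_slash_T : E2 ∣[(2 : ℤ)] T = E2 := by
  rw [EisensteinSeries.E2_slash_action, EisensteinSeries.D2_T, smul_zero, sub_zero]

lemma tendsto_E2 : Tendsto E2 atImInfty (𝓝 1) := by
  have hper := periodic_of_slash_T E2_slash_T
  have han := analyticAt_cuspFunction_zero one_pos hper E2_mdifferentiable
    EisensteinSeries.isBoundedAtImInfty_E2
  have hs (τ : ℍ) : HasSum (fun m : ℕ => (if m = 0 then 1 else
      -24 * (ArithmeticFunction.sigma 1 m : ℂ)) • Function.Periodic.qParam 1 (τ : ℂ) ^ m)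
      (E2 τ) := by
    simpa only [Function.Periodic.qParam, Complex.ofReal_one, div_one] using
      EisensteinSeries.hasSum_qExpansion_E2 (z := τ)
  have h := (hasFPowerSeriesOnBall_cuspFunction one_pos han hs).coeff_zero 0
  have h2 := cuspFunction_apply_zero one_pos han hper
  have h3 := tendsto_valueAtInfty one_pos hper E2_mdifferentiable
    EisensteinSeries.isBoundedAtImInfty_E2
  rw [← h2, ← h] at h3
  simpa using h3

/-- The constant in the transformation law of `E₂`. -/
def kap : ℂ := 1 / (2 * riemannZeta 2) * (2 * Real.pi * Complex.I)

/-- The quasi-modular transformation law of `E₂`, cleared of denominators. -/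
lemma E2_smul (γ : SL(2, ℤ)) (τ : ℍ) :
    E2 (γ • τ) = denom γ τ ^ 2 * E2 τ - kap * γ 1 0 * denom γ τ := by
  have h := congrFun (EisensteinSeries.E2_slash_action γ) τ
  have hd := denom_ne_zero γ τ
  rw [ModularForm.SL_slash_apply] at h
  simp only [EisensteinSeries.D2, Pi.sub_apply, Pi.smul_apply, smul_eq_mul] at h
  rw [zpow_neg, ← div_eq_mul_inv, div_eq_iff (zpow_ne_zero _ hd)] at h
  rw [h, kap]
  generalize riemannZeta 2 = x
  rw [show denom γ τ ^ (2 : ℤ) = denom γ τ ^ 2 from rfl]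
  generalize 1 / (2 * x) = y
  field_simp

lemma coe_dbl (τ : ℍ) : (dbl τ : ℂ) = 2 * τ := by
  rw [dbl, coe_pos_real_smul]; simp

lemma coe_half (τ : ℍ) : (half τ : ℂ) = τ / 2 := by
  rw [half, coe_pos_real_smul]; simp; ring

lemma half_dbl (τ : ℍ) : half (dbl τ) = τ := by
  ext; rw [coe_half, coe_dbl]; ring

lemma dbl_half (τ : ℍ) : dbl (half τ) = τ := by
  ext; rw [coe_dbl, coe_half]; ring

lemma im_dbl (τ : ℍ) : (dbl τ).im = 2 * τ.im := by
  rw [dbl, pos_real_im]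

lemma im_half (τ : ℍ) : (half τ).im = τ.im / 2 := by
  rw [half, pos_real_im]; simp; ring

lemma tendsto_dbl : Tendsto dbl atImInfty atImInfty := by
  rw [atImInfty, tendsto_comap_iff]
  refine (tendsto_comap.const_mul_atTop (two_pos (α := ℝ))).congr ?_
  intro τ; simp [im_dbl]

lemma tendsto_half : Tendsto half atImInfty atImInfty := by
  rw [atImInfty, tendsto_comap_iff]
  refine (tendsto_comap.atTop_div_const (two_pos (α := ℝ))).congr ?_
  intro τ; simp [im_half]

lemma mdiff_comp_pos_smul {f : ℍ → ℂ} (hf : MDiff f) (a : {x : ℝ // 0 < x}) :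
    MDiff (fun τ : ℍ => f (a • τ)) := by
  rw [UpperHalfPlane.mdifferentiable_iff] at hf ⊢
  have : DifferentiableOn ℂ (fun z : ℂ => (f ∘ ofComplex) ((a : ℝ) * z)) {z | 0 < z.im} :=
    hf.comp (by fun_prop) fun z hz => by simpa using mul_pos a.2 hz
  refine this.congr fun z hz => ?_
  have hz' : 0 < ((a : ℝ) * z : ℂ).im := by simpa using mul_pos a.2 hz
  simp only [Function.comp_apply]
  rw [ofComplex_apply_of_im_pos hz, ofComplex_apply_of_im_pos hz']
  congr 1

lemma mdiff_e1 : MDiff e1 :=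
  ((mdiff_comp_pos_smul E2_mdifferentiable ⟨2, two_pos⟩).const_smul (2 : ℂ)).sub E2_mdifferentiable

lemma tendsto_e1 : Tendsto e1 atImInfty (𝓝 1) := by
  have := ((tendsto_E2.comp tendsto_dbl).const_mul 2).sub tendsto_E2
  norm_num at this; exact this

lemma tendsto_e2 : Tendsto e2 atImInfty (𝓝 (1 / 2)) := by
  have := tendsto_E2.sub ((tendsto_E2.comp tendsto_half).const_mul (1 / 2))
  norm_num at this; exact this

lemma dbl_S_smul (τ : ℍ) : dbl (S • τ) = S • half τ := by
  ext
  rw [coe_dbl, modular_S_smul, modular_S_smul]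
  simp [coe_half]; ring

lemma e1_slash_S : e1 ∣[(2 : ℤ)] S = -e2 := by
  ext τ
  have hτ := τ.ne_zero
  rw [ModularForm.SL_slash_apply, denom_S, e1, dbl_S_smul, E2_smul, E2_smul, denom_S, denom_S,
    coe_half]
  simp only [Pi.neg_apply, e2, zpow_neg, ModularGroup.S]
  simp
  field_simp
  ring

/-- Conjugation by the doubling map turns an element of `Γ₀(2)` into an element of `SL₂(ℤ)`. -/
lemma exists_dbl_smul {γ : SL(2, ℤ)} (hγ : γ ∈ Gamma0 2) :
    ∃ γ' : SL(2, ℤ), γ 1 0 = 2 * γ' 1 0 ∧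
      ∀ τ : ℍ, dbl (γ • τ) = γ' • dbl τ ∧ denom γ' (dbl τ) = denom γ τ := by
  obtain ⟨c, hc⟩ : (2 : ℤ) ∣ γ 1 0 := (ZMod.intCast_zmod_eq_zero_iff_dvd _ 2).1 (Gamma0_mem.1 hγ)
  have hdet := γ.det_coe
  rw [Matrix.det_fin_two, hc] at hdet
  let γ' : SL(2, ℤ) := ⟨!![γ 0 0, 2 * γ 0 1; c, γ 1 1], by rw [Matrix.det_fin_two_of]; linarith⟩
  refine ⟨γ', hc, fun τ => ⟨?_, ?_⟩⟩
  · ext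
    rw [coe_dbl, coe_specialLinearGroup_apply, coe_specialLinearGroup_apply, coe_dbl]
    simp [γ', hc]
    ring
  · rw [denom_apply, denom_apply, coe_dbl]
    simp [γ', hc]; ring

/-- The quasi-modular defects of `2 E₂(2τ)` and `E₂(τ)` under `Γ₀(2)` cancel. -/
lemma e1_slash_Gamma0 {γ : SL(2, ℤ)} (hγ : γ ∈ Gamma0 2) : e1 ∣[(2 : ℤ)] γ = e1 := by
  obtain ⟨γ', hc, h⟩ := exists_dbl_smul hγ
  ext τ
  have hd := denom_ne_zero γ τ
  rw [ModularForm.SL_slash_apply, e1, (h τ).1, E2_smul, E2_smul, (h τ).2, e1, zpow_neg,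
    ← div_eq_mul_inv, div_eq_iff (zpow_ne_zero _ hd)]
  rw [show denom γ τ ^ (2 : ℤ) = denom γ τ ^ 2 from rfl, hc]
  push_cast
  ring

lemma e2_slash_S : e2 ∣[(2 : ℤ)] S = -e1 := by
  have h : (S * S : SL(2, ℤ)) ∈ Gamma0 2 := by
    rw [Gamma0_mem, show (S * S : SL(2, ℤ)) 1 0 = 0 from rfl, Int.cast_zero]
  rw [← e1_slash_Gamma0 h, SlashAction.slash_mul, e1_slash_S]
  simp [SlashAction.neg_slash]

lemma Gamma_le_Gamma0 : Gamma 2 ≤ Gamma0 2 := fun _ hγ => Gamma0_mem.2 (Gamma_mem.1 hγ).2.2.1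

lemma T_mem_Gamma0 : T ∈ Gamma0 2 := by
  rw [Gamma0_mem]; simp [ModularGroup.T]

lemma e1_slash_T : e1 ∣[(2 : ℤ)] T = e1 := e1_slash_Gamma0 T_mem_Gamma0

/-- The cosets of `Γ₀(2)` in `SL₂(ℤ)` are represented by `1`, `S`, `ST`. -/
lemma Gamma0_two_cosets (γ : SL(2, ℤ)) :
    γ ∈ Gamma0 2 ∨ γ * S⁻¹ ∈ Gamma0 2 ∨ γ * (S * T)⁻¹ ∈ Gamma0 2 := by
  have h1 : (γ * S⁻¹) 1 0 = - γ 1 1 := by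
    rw [Matrix.SpecialLinearGroup.coe_mul]
    simp [coe_S, Matrix.SpecialLinearGroup.coe_inv, Matrix.mul_apply, Fin.sum_univ_two,
      Matrix.adjugate_fin_two]
  have h2 : (γ * (S * T)⁻¹) 1 0 = γ 1 0 - γ 1 1 := by
    rw [Matrix.SpecialLinearGroup.coe_mul]
    simp [coe_S, coe_T, Matrix.SpecialLinearGroup.coe_inv, Matrix.SpecialLinearGroup.coe_mul,
      Matrix.mul_apply, Fin.sum_univ_two, Matrix.adjugate_fin_two]
    ring
  rw [Gamma0_mem, Gamma0_mem, Gamma0_mem, h1, h2]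
  push_cast
  generalize ((γ 1 0 : ℤ) : ZMod 2) = a
  generalize ((γ 1 1 : ℤ) : ZMod 2) = b
  revert a b; decide

lemma isBoundedAtImInfty_of_tendsto {f : ℍ → ℂ} {c : ℂ} (h : Tendsto f atImInfty (𝓝 c)) :
    IsBoundedAtImInfty f := h.isBigO_one ℝ

lemma e1_mem_forms : e1 ∈ forms (Gamma0 2) 2 := by
  refine ⟨mdiff_e1, fun γ hγ => e1_slash_Gamma0 hγ, fun γ => ?_⟩
  have h2 := isBoundedAtImInfty_of_tendsto tendsto_e2
  rcases Gamma0_two_cosets γ with h | h | h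
  · rw [e1_slash_Gamma0 h]
    exact isBoundedAtImInfty_of_tendsto tendsto_e1
  · rw [show γ = γ * S⁻¹ * S by group, SlashAction.slash_mul, e1_slash_Gamma0 h, e1_slash_S]
    exact h2.neg
  · rw [show γ = γ * (S * T)⁻¹ * (S * T) by group, SlashAction.slash_mul, e1_slash_Gamma0 h,
      SlashAction.slash_mul, e1_slash_S, SlashAction.neg_slash]
    exact BoundedAtFilter.neg (h2.slash 2 (by simp [coe_T]))

lemma e1_mem : e1 ∈ forms (Gamma 2) 2 := forms_mono Gamma_le_Gamma0 2 e1_mem_forms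

lemma e2_mem : e2 ∈ forms (Gamma 2) 2 := by
  have h : e2 = -(e1 ∣[(2 : ℤ)] S) := by rw [e1_slash_S, neg_neg]
  rw [h]
  exact neg_mem (slash_mem_forms e1_mem S)

lemma slash_T_T {k : ℤ} {f : ℍ → ℂ} (hf : f ∈ forms (Gamma 2) k) : (f ∣[k] T) ∣[k] T = f := by
  rw [← SlashAction.slash_mul, ← sq, hf.2.1 _ T_sq_mem_Gamma_two]

lemma mem_forms_top {k : ℤ} {f : ℍ → ℂ} (hf : f ∈ forms (Gamma 2) k) (hS : f ∣[k] S = f)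
    (hT : f ∣[k] T = f) : f ∈ forms ⊤ k :=
  ⟨hf.1, fun γ _ => SlashInvariantForm.slash_action_generators_SL2Z hS hT γ, hf.2.2⟩

lemma forms_top_two {f : ℍ → ℂ} (hf : f ∈ forms ⊤ 2) : f = 0 := by
  obtain ⟨g, rfl⟩ := mem_forms_top_iff.1 hf
  rw [rank_zero_iff_forall_zero.1 ModularForm.levelOne_weight_two_rank_zero g]; rfl

/-- The three Eisenstein series `e₁`, `e₂`, `e₂(τ + 1)` satisfy a linear relation: the defect is a
form of weight `2` and level one, hence zero. -/
lemma e2_slash_T : e2 ∣[(2 : ℤ)] T = e1 - e2 := by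
  have hD : e2 + e2 ∣[(2 : ℤ)] T - e1 ∈ forms (Gamma 2) 2 :=
    sub_mem (add_mem e2_mem (slash_mem_forms e2_mem T)) e1_mem
  have hST : (S * T * S : SL(2, ℤ)) = T⁻¹ * S * T⁻¹ := by
    ext i j; fin_cases i <;> fin_cases j <;> rfl
  have he1 : e1 ∣[(2 : ℤ)] T⁻¹ = e1 := e1_slash_Gamma0 (inv_mem T_mem_Gamma0)
  have he2 : e2 ∣[(2 : ℤ)] T⁻¹ = e2 ∣[(2 : ℤ)] T := by
    conv_lhs => rw [← slash_T_T e2_mem]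
    rw [← SlashAction.slash_mul, mul_inv_cancel, SlashAction.slash_one]
  have h : (e2 ∣[(2 : ℤ)] T) ∣[(2 : ℤ)] S = e2 ∣[(2 : ℤ)] T := by
    have : e2 = -(e1 ∣[(2 : ℤ)] S) := by rw [e1_slash_S, neg_neg]
    conv_lhs => rw [this]
    rw [SlashAction.neg_slash, SlashAction.neg_slash, ← SlashAction.slash_mul,
      ← SlashAction.slash_mul, ← mul_assoc, hST, SlashAction.slash_mul, SlashAction.slash_mul, he1,
      e1_slash_S, SlashAction.neg_slash, neg_neg, he2]
  have h0 := forms_top_two (mem_forms_top hD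
    (by rw [sub_eq_add_neg, SlashAction.add_slash, SlashAction.add_slash, SlashAction.neg_slash, h,
          e2_slash_S, e1_slash_S]; abel)
    (by rw [sub_eq_add_neg, SlashAction.add_slash, SlashAction.add_slash, SlashAction.neg_slash,
          slash_T_T e2_mem, e1_slash_T]; abel))
  rw [sub_eq_zero] at h0
  rw [← h0]; abel

/-! ### Forms of level two and their cusps -/

lemma forms_cast {Γ : Subgroup SL(2, ℤ)} {k l : ℤ} {f : ℍ → ℂ} (hf : f ∈ forms Γ k)
    (h : k = l) : f ∈ forms Γ l := h ▸ hf

lemma forms_mul_eq_zero {k l : ℤ} {f g : ℍ → ℂ} (hf : f ∈ forms (Gamma 2) k)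
    (hg : g ∈ forms (Gamma 2) l) (h : f * g = 0) : f = 0 ∨ g = 0 := by
  obtain ⟨F, rfl⟩ := mem_forms_iff.1 hf
  obtain ⟨G, rfl⟩ := mem_forms_iff.1 hg
  by_contra! hne
  refine ModularForm.mul_ne_zero ⟨2, by simp, two_pos⟩ (f := F) (g := G) ?_ ?_ ?_
  · rintro rfl; exact hne.1 rfl
  · rintro rfl; exact hne.2 rfl
  · exact DFunLike.coe_injective h

lemma forms_zero_const {Γ : Subgroup SL(2, ℤ)} [Γ.FiniteIndex] {f : ℍ → ℂ}
    (hf : f ∈ forms Γ 0) : ∃ c : ℂ, f = fun _ => c := by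
  obtain ⟨F, rfl⟩ := mem_forms_iff.1 hf
  exact ModularForm.eq_const_of_weight_zero F

lemma discriminant_slash (γ : SL(2, ℤ)) :
    ModularForm.discriminant ∣[(12 : ℤ)] γ = ModularForm.discriminant :=
  SlashInvariantForm.slash_action_generators_SL2Z ModularForm.discriminant_S_invariant
    ModularForm.discriminant_T_invariant γ

/-- A level one form that vanishes at `i∞` is divisible by the discriminant. -/
lemma exists_discriminant_mul {k : ℤ} {f : ℍ → ℂ} (hf : f ∈ forms ⊤ k)
    (h0 : Tendsto f atImInfty (𝓝 0)) :
    ∃ g ∈ forms ⊤ (k - 12), f = ModularForm.discriminant * g := by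
  obtain ⟨F, rfl⟩ := mem_forms_top_iff.1 hf
  let C : CuspForm 𝒮ℒ k :=
    { toFun := F, slash_action_eq' := F.slash_action_eq', holo' := F.holo', zero_at_cusps' := by
        intro c hc
        rw [Subgroup.IsArithmetic.isCusp_iff_isCusp_SL2Z] at hc
        rw [OnePoint.isZeroAt_iff_forall_SL2Z hc]
        intro γ _
        change IsZeroAtImInfty (⇑F ∣[k] γ)
        rw [hf.2.1 γ (Subgroup.mem_top γ)]
        exact h0 }
  exact ⟨CuspForm.discriminantEquiv C, mem_forms_top_iff.2 ⟨_, rfl⟩,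
    (ModularForm.discriminant_mul_discriminantEquiv C).symm⟩

/-- For `f` of level two, the slash `f ∣[k] γ` only depends on `γ` modulo `2`. -/
lemma slash_congr {k : ℤ} {f : ℍ → ℂ} (hf : f ∈ forms (Gamma 2) k) {γ δ : SL(2, ℤ)}
    (h : γ * δ⁻¹ ∈ Gamma 2) : f ∣[k] γ = f ∣[k] δ := by
  rw [show γ = γ * δ⁻¹ * δ by group, SlashAction.slash_mul, hf.2.1 _ h]

lemma e1_S (τ : ℍ) : e1 (S • τ) = -(τ : ℂ) ^ 2 * e2 τ := by
  have h := congrFun e1_slash_S τ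
  have hτ := τ.ne_zero
  rw [ModularForm.SL_slash_apply, denom_S, zpow_neg, ← div_eq_mul_inv,
    div_eq_iff (zpow_ne_zero _ hτ)] at h
  rw [h, Pi.neg_apply, show (τ : ℂ) ^ (2 : ℤ) = (τ : ℂ) ^ 2 from rfl]; ring

lemma e2_S (τ : ℍ) : e2 (S • τ) = -(τ : ℂ) ^ 2 * e1 τ := by
  have h := congrFun e2_slash_S τ
  have hτ := τ.ne_zero
  rw [ModularForm.SL_slash_apply, denom_S, zpow_neg, ← div_eq_mul_inv,
    div_eq_iff (zpow_ne_zero _ hτ)] at h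
  rw [h, Pi.neg_apply, show (τ : ℂ) ^ (2 : ℤ) = (τ : ℂ) ^ 2 from rfl]; ring

lemma e1_T (τ : ℍ) : e1 ((1 : ℝ) +ᵥ τ) = e1 τ := by
  rw [← slash_T_apply e1 2, e1_slash_T]

lemma e2_T (τ : ℍ) : e2 ((1 : ℝ) +ᵥ τ) = e1 τ - e2 τ := by
  rw [← slash_T_apply e2 2, e2_slash_T]; rfl

/-- A form of weight two that vanishes, among the three cusps of `Γ(2)`, exactly at `i∞`. -/
def wInf (τ : ℍ) : ℂ := 2 * e2 τ - e1 τ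

/-- A form of weight two that vanishes, among the three cusps of `Γ(2)`, exactly at `0`. -/
def wZero (τ : ℍ) : ℂ := 2 * e1 τ - e2 τ

/-- A form of weight two that vanishes, among the three cusps of `Γ(2)`, exactly at `1`. -/
def wOne (τ : ℍ) : ℂ := e1 τ + e2 τ

lemma wInf_mem : wInf ∈ forms (Gamma 2) 2 :=
  sub_mem (Submodule.smul_mem _ (2 : ℂ) e2_mem) e1_mem

lemma wZero_mem : wZero ∈ forms (Gamma 2) 2 :=
  sub_mem (Submodule.smul_mem _ (2 : ℂ) e1_mem) e2_mem

lemma wOne_mem : wOne ∈ forms (Gamma 2) 2 := add_mem e1_mem e2_mem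

lemma slash_S_apply' (f : ℍ → ℂ) (k : ℤ) (z : ℍ) : (f ∣[k] S) z = f (S • z) * (z : ℂ) ^ (-k) := by
  rw [ModularForm.SL_slash_apply, denom_S]

lemma wInf_slash_S : wInf ∣[(2 : ℤ)] S = -wZero := by
  ext τ
  have hτ := τ.ne_zero
  rw [slash_S_apply', Pi.neg_apply, wInf, wZero, e1_S, e2_S]
  simp only [zpow_neg]
  rw [show (τ : ℂ) ^ (2 : ℤ) = (τ : ℂ) ^ 2 from rfl]
  field_simp; ring

lemma wZero_slash_S : wZero ∣[(2 : ℤ)] S = -wInf := by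
  ext τ
  have hτ := τ.ne_zero
  rw [slash_S_apply', Pi.neg_apply, wInf, wZero, e1_S, e2_S]
  simp only [zpow_neg]
  rw [show (τ : ℂ) ^ (2 : ℤ) = (τ : ℂ) ^ 2 from rfl]
  field_simp; ring

lemma wOne_slash_S : wOne ∣[(2 : ℤ)] S = -wOne := by
  ext τ
  have hτ := τ.ne_zero
  rw [slash_S_apply', Pi.neg_apply, wOne, wOne, e1_S, e2_S]
  simp only [zpow_neg]
  rw [show (τ : ℂ) ^ (2 : ℤ) = (τ : ℂ) ^ 2 from rfl]
  field_simp; ring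

lemma wInf_slash_T : wInf ∣[(2 : ℤ)] T = -wInf := by
  ext τ
  rw [slash_T_apply, Pi.neg_apply, wInf, wInf, e1_T, e2_T]; ring

lemma wZero_slash_T : wZero ∣[(2 : ℤ)] T = wOne := by
  ext τ
  rw [slash_T_apply, wZero, wOne, e1_T, e2_T]; ring

lemma wOne_slash_T : wOne ∣[(2 : ℤ)] T = wZero := by
  ext τ
  rw [slash_T_apply, wZero, wOne, e1_T, e2_T]; ring

lemma tendsto_wInf : Tendsto wInf atImInfty (𝓝 0) := by
  have := (tendsto_e2.const_mul 2).sub tendsto_e1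
  norm_num at this; exact this

lemma tendsto_wZero : Tendsto wZero atImInfty (𝓝 (3 / 2)) := by
  have := (tendsto_e1.const_mul 2).sub tendsto_e2
  norm_num at this; exact this

lemma tendsto_wOne : Tendsto wOne atImInfty (𝓝 (3 / 2)) := by
  have := tendsto_e1.add tendsto_e2
  norm_num at this; exact this

lemma ne_zero_of_tendsto {f : ℍ → ℂ} {c : ℂ} (h : Tendsto f atImInfty (𝓝 c)) (hc : c ≠ 0) :
    f ≠ 0 := by
  rintro rfl
  exact hc (tendsto_nhds_unique h tendsto_const_nhds)

lemma wProd_mem : wInf * wZero * wOne ∈ forms (Gamma 2) 6 :=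
  forms_cast (mul_mem_forms (mul_mem_forms wInf_mem wZero_mem) wOne_mem) (by norm_num)

lemma wProd_ne_zero : wInf * wZero * wOne ≠ 0 := by
  have h0 := ne_zero_of_tendsto tendsto_wZero (by norm_num)
  have h1 := ne_zero_of_tendsto tendsto_wOne (by norm_num)
  have h2 : wInf ≠ 0 := by
    intro h
    have := wInf_slash_S
    rw [h, SlashAction.zero_slash, eq_comm, neg_eq_zero] at this
    exact h0 this
  intro h
  rcases forms_mul_eq_zero (mul_mem_forms wInf_mem wZero_mem) wOne_mem h with h | h
  · rcases forms_mul_eq_zero wInf_mem wZero_mem h with h | h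
    · exact h2 h
    · exact h0 h
  · exact h1 h

lemma wProd_slash_S : (wInf * wZero * wOne) ∣[(6 : ℤ)] S = -(wInf * wZero * wOne) := by
  rw [show (6 : ℤ) = 2 + 2 + 2 by norm_num, ModularForm.mul_slash_SL2, ModularForm.mul_slash_SL2,
    wInf_slash_S, wZero_slash_S, wOne_slash_S]
  ring

lemma wProd_slash_T : (wInf * wZero * wOne) ∣[(6 : ℤ)] T = -(wInf * wZero * wOne) := by
  rw [show (6 : ℤ) = 2 + 2 + 2 by norm_num, ModularForm.mul_slash_SL2, ModularForm.mul_slash_SL2,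
    wInf_slash_T, wZero_slash_T, wOne_slash_T]
  ring

/-- The square of `wInf wZero wOne` has level one and weight twelve, and it vanishes at `i∞`. -/
lemma wProd_sq : ∃ c : ℂ, c ≠ 0 ∧
    (wInf * wZero * wOne) * (wInf * wZero * wOne) = c • ModularForm.discriminant := by
  have hmem : (wInf * wZero * wOne) * (wInf * wZero * wOne) ∈ forms ⊤ 12 :=
    mem_forms_top (forms_cast (mul_mem_forms wProd_mem wProd_mem) (by norm_num))
      (by rw [show (12 : ℤ) = 6 + 6 by norm_num, ModularForm.mul_slash_SL2, wProd_slash_S,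
            neg_mul_neg])
      (by rw [show (12 : ℤ) = 6 + 6 by norm_num, ModularForm.mul_slash_SL2, wProd_slash_T,
            neg_mul_neg])
  have ht : Tendsto (wInf * wZero * wOne) atImInfty (𝓝 0) := by
    simpa using! (tendsto_wInf.mul tendsto_wZero).mul tendsto_wOne
  obtain ⟨g, hg, h⟩ := exists_discriminant_mul hmem (by simpa using! ht.mul ht)
  obtain ⟨c, rfl⟩ := forms_zero_const (forms_cast hg (by norm_num : (12 : ℤ) - 12 = 0))
  have h' : (wInf * wZero * wOne) * (wInf * wZero * wOne) = c • ModularForm.discriminant := by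
    rw [h]; ext τ; simp [mul_comm]
  refine ⟨c, ?_, h'⟩
  rintro rfl
  rw [zero_smul] at h'
  exact wProd_ne_zero (funext fun τ => mul_self_eq_zero.1 (congrFun h' τ))

/-- The function `η¹²` on the upper half-plane. -/
def eta12 (τ : ℍ) : ℂ := ModularForm.eta τ ^ 12

lemma eta12_ne_zero (τ : ℍ) : eta12 τ ≠ 0 := pow_ne_zero _ (ModularForm.eta_ne_zero τ.2)

lemma eta12_sq : eta12 * eta12 = ModularForm.discriminant := by
  ext τ; simp only [eta12, ModularForm.discriminant, Pi.mul_apply]; ring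

lemma mdiff_eta12 : MDiff eta12 := by
  rw [UpperHalfPlane.mdifferentiable_iff]
  refine .congr (fun z hz ↦ (ModularForm.differentiableAt_eta_of_mem_upperHalfPlaneSet hz).pow
      12 |>.differentiableWithinAt) fun z hz ↦ ?_
  simp [eta12, ofComplex_apply_of_im_pos hz]

/-- Both sides are continuous on the connected space `ℍ` and have proportional squares, and
`η¹²` has no zeros, so they agree up to a constant. -/
lemma wProd_eq : ∃ d : ℂ, d ≠ 0 ∧ wInf * wZero * wOne = d • eta12 := by
  obtain ⟨c, hc, h⟩ := wProd_sq
  obtain ⟨d, rfl⟩ := IsAlgClosed.exists_eq_mul_self c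
  have hd : d ≠ 0 := by rintro rfl; simp at hc
  have hsq : Set.EqOn ((wInf * wZero * wOne) ^ 2) ((d • eta12) ^ 2) Set.univ := by
    intro τ _
    rw [sq, h, ← eta12_sq]
    simp only [Pi.smul_apply, Pi.mul_apply, Pi.pow_apply, smul_eq_mul]; ring
  rcases isPreconnected_univ.eq_or_eq_neg_of_sq_eq wProd_mem.1.continuous.continuousOn
    (mdiff_eta12.const_smul d).continuous.continuousOn hsq
    (fun {τ} _ => mul_ne_zero hd (eta12_ne_zero τ)) with h1 | h1
  · exact ⟨d, hd, funext fun τ => h1 (Set.mem_univ τ)⟩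
  · exact ⟨-d, neg_ne_zero.2 hd, funext fun τ => by
      rw [h1 (Set.mem_univ τ)]; simp⟩

/-- `wInf` divides a nonzero multiple of `η¹²`. -/
lemma wInf_ne_zero (τ : ℍ) : wInf τ ≠ 0 := by
  obtain ⟨d, hd, h⟩ := wProd_eq
  have h1 := mul_ne_zero hd (eta12_ne_zero τ)
  have h2 := congrFun h τ
  simp only [Pi.mul_apply, Pi.smul_apply, smul_eq_mul] at h2
  rw [← h2] at h1
  exact left_ne_zero_of_mul (left_ne_zero_of_mul h1)

lemma eta12_mem : eta12 ∈ forms (Gamma 2) 6 := by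
  obtain ⟨d, hd, h⟩ := wProd_eq
  rw [show eta12 = d⁻¹ • (wInf * wZero * wOne) by rw [h, smul_smul, inv_mul_cancel₀ hd, one_smul]]
  exact Submodule.smul_mem _ _ wProd_mem

lemma eta12_slash_S : eta12 ∣[(6 : ℤ)] S = -eta12 := by
  obtain ⟨d, hd, h⟩ := wProd_eq
  rw [show eta12 = d⁻¹ • (wInf * wZero * wOne) by rw [h, smul_smul, inv_mul_cancel₀ hd, one_smul],
    ModularForm.SL_smul_slash, wProd_slash_S, smul_neg]

lemma eta12_slash_T : eta12 ∣[(6 : ℤ)] T = -eta12 := by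
  obtain ⟨d, hd, h⟩ := wProd_eq
  rw [show eta12 = d⁻¹ • (wInf * wZero * wOne) by rw [h, smul_smul, inv_mul_cancel₀ hd, one_smul],
    ModularForm.SL_smul_slash, wProd_slash_T, smul_neg]

lemma tendsto_eta12 : Tendsto eta12 atImInfty (𝓝 0) := by
  obtain ⟨d, hd, h⟩ := wProd_eq
  rw [show eta12 = d⁻¹ • (wInf * wZero * wOne) by rw [h, smul_smul, inv_mul_cancel₀ hd, one_smul]]
  simpa using! ((tendsto_wInf.mul tendsto_wZero).mul tendsto_wOne).const_smul d⁻¹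

lemma eta12_slash_sq (γ : SL(2, ℤ)) :
    (eta12 ∣[(6 : ℤ)] γ) * (eta12 ∣[(6 : ℤ)] γ) = ModularForm.discriminant := by
  rw [← ModularForm.mul_slash_SL2, eta12_sq]
  exact discriminant_slash γ

/-- `η¹²` decays at each cusp no faster than `q^{1/2}`, the slowest decay of a form of level two
that vanishes there. -/
lemma exp_isBigO_eta12_slash (γ : SL(2, ℤ)) :
    (fun τ : ℍ => Real.exp (-2 * Real.pi * τ.im / 2)) =O[atImInfty] (eta12 ∣[(6 : ℤ)] γ) := by
  have h := ModularForm.exp_isBigO_discriminant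
  rw [← eta12_slash_sq γ] at h
  refine Asymptotics.IsBigO.of_pow (n := 2) two_ne_zero ?_
  refine (h.congr (fun τ => ?_) (fun τ => ?_))
  · simp only [Pi.pow_apply]
    rw [← Real.exp_nat_mul]; congr 1; push_cast; ring
  · simp only [Pi.mul_apply, Pi.pow_apply]; ring

/-- A form of level two that vanishes at all cusps is divisible by `η¹²`, which has no zero on the
upper half-plane and only simple zeros at the cusps. -/
lemma div_eta12_mem {k : ℤ} {f : ℍ → ℂ} (hf : f ∈ forms (Gamma 2) k)
    (h0 : ∀ γ : SL(2, ℤ), Tendsto (f ∣[k] γ) atImInfty (𝓝 0)) :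
    f / eta12 ∈ forms (Gamma 2) (k - 6) := by
  refine ⟨hf.1.div mdiff_eta12 eta12_ne_zero, fun γ hγ => ?_, fun γ => ?_⟩
  · rw [ModularForm.div_slash_SL2, hf.2.1 γ hγ, eta12_mem.2.1 γ hγ]
  · rw [ModularForm.div_slash_SL2]
    have hγ := slash_mem_forms hf γ
    have h1 := IsZeroAtImInfty.exp_decay_atImInfty (h0 γ) two_pos (periodic_of_mem_forms hγ) hγ.1
      (bounded_of_mem_forms hγ)
    exact (Asymptotics.div_isBoundedUnder_of_isBigO
      (h1.trans (exp_isBigO_eta12_slash γ))).isBigO_one ℝ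

lemma mem_Gamma_or_of_mem_Gamma0 {γ : SL(2, ℤ)} (hγ : γ ∈ Gamma0 2) :
    γ ∈ Gamma 2 ∨ γ * T⁻¹ ∈ Gamma 2 := by
  have h (i : Fin 2) : (γ * T⁻¹) i 0 = γ i 0 ∧ (γ * T⁻¹) i 1 = γ i 1 - γ i 0 := by
    rw [Matrix.SpecialLinearGroup.coe_mul]
    simp [Matrix.mul_apply, Fin.sum_univ_two]
    ring
  have hdet := γ.det_coe
  rw [Matrix.det_fin_two] at hdet
  have hdet' := congrArg (Int.cast : ℤ → ZMod 2) hdet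
  rw [Gamma0_mem] at hγ
  rw [Gamma_mem, Gamma_mem, (h 0).1, (h 0).2, (h 1).1, (h 1).2]
  push_cast at hdet' ⊢
  rw [hγ] at hdet' ⊢
  revert hdet'
  generalize ((γ 0 0 : ℤ) : ZMod 2) = a
  generalize ((γ 0 1 : ℤ) : ZMod 2) = b
  generalize ((γ 1 1 : ℤ) : ZMod 2) = c
  revert a b c; decide

lemma slash_S_inv {k : ℤ} {f : ℍ → ℂ} (hf : f ∈ forms (Gamma 2) k) :
    f ∣[k] S⁻¹ = f ∣[k] S := by
  refine slash_congr hf ?_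
  rw [Gamma_mem]; decide

/-- The cusps of `Γ(2)` are `i∞`, `0` and `1`. -/
lemma tendsto_slash_of_cusps {k : ℤ} {f : ℍ → ℂ} (hf : f ∈ forms (Gamma 2) k)
    (h1 : Tendsto f atImInfty (𝓝 0)) (h2 : Tendsto (f ∣[k] S) atImInfty (𝓝 0))
    (h3 : Tendsto ((f ∣[k] T) ∣[k] S) atImInfty (𝓝 0)) (γ : SL(2, ℤ)) :
    Tendsto (f ∣[k] γ) atImInfty (𝓝 0) := by
  have key {g : ℍ → ℂ} (hg : g ∈ forms (Gamma 2) k) (hg0 : Tendsto g atImInfty (𝓝 0))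
      {δ : SL(2, ℤ)} (hδ : δ ∈ Gamma0 2) : Tendsto (g ∣[k] δ) atImInfty (𝓝 0) := by
    rcases mem_Gamma_or_of_mem_Gamma0 hδ with h | h
    · rwa [hg.2.1 δ h]
    · rw [slash_congr hg h]
      exact IsZeroAtImInfty.slash k (by simp [coe_T]) hg0
  rcases Gamma0_two_cosets γ⁻¹ with h | h | h
  · exact key hf h1 (inv_mem_iff.1 h)
  · rw [show γ = S⁻¹ * (γ⁻¹ * S⁻¹)⁻¹ by group, SlashAction.slash_mul]
    exact key (slash_mem_forms hf _) (by rwa [slash_S_inv hf]) (inv_mem h)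
  · rw [show γ = (T⁻¹ * S⁻¹) * (γ⁻¹ * (S * T)⁻¹)⁻¹ by group, SlashAction.slash_mul]
    refine key (slash_mem_forms hf _) ?_ (inv_mem h)
    rwa [slash_congr hf (δ := T * S) (by rw [Gamma_mem]; decide), SlashAction.slash_mul]

/-- A form of level two that vanishes at `i∞` is divisible by `wInf`. -/
lemma exists_wInf_mul {k : ℤ} {f : ℍ → ℂ} (hf : f ∈ forms (Gamma 2) k)
    (h0 : valueAtInfty f = 0) : ∃ g ∈ forms (Gamma 2) (k - 2), f = wInf * g := by
  obtain ⟨d, hd, hP⟩ := wProd_eq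
  have hfw : f * (wZero * wOne) ∈ forms (Gamma 2) (k + (2 + 2)) :=
    mul_mem_forms hf (mul_mem_forms wZero_mem wOne_mem)
  have hft := tendsto_of_mem_forms hf
  rw [h0] at hft
  have h1 : Tendsto (f * (wZero * wOne)) atImInfty (𝓝 0) := by
    simpa using! hft.mul (tendsto_wZero.mul tendsto_wOne)
  have h2 : Tendsto ((f * (wZero * wOne)) ∣[k + (2 + 2)] S) atImInfty (𝓝 0) := by
    rw [ModularForm.mul_slash_SL2, ModularForm.mul_slash_SL2, wZero_slash_S, wOne_slash_S]
    simpa using! (tendsto_of_mem_forms (slash_mem_forms hf S)).mul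
      (tendsto_wInf.neg.mul tendsto_wOne.neg)
  have h3 : Tendsto (((f * (wZero * wOne)) ∣[k + (2 + 2)] T) ∣[k + (2 + 2)] S)
      atImInfty (𝓝 0) := by
    rw [ModularForm.mul_slash_SL2, ModularForm.mul_slash_SL2 2 2, wZero_slash_T, wOne_slash_T,
      ModularForm.mul_slash_SL2, ModularForm.mul_slash_SL2, wZero_slash_S, wOne_slash_S]
    simpa using! (tendsto_of_mem_forms (slash_mem_forms (slash_mem_forms hf T) S)).mul
      (tendsto_wOne.neg.mul tendsto_wInf.neg)
  have h := div_eta12_mem hfw (tendsto_slash_of_cusps hfw h1 h2 h3)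
  refine ⟨d⁻¹ • (f * (wZero * wOne) / eta12),
    Submodule.smul_mem _ _ (forms_cast h (by ring)), ?_⟩
  ext τ
  have h4 := congrFun hP τ
  have h5 := eta12_ne_zero τ
  simp only [Pi.mul_apply, Pi.smul_apply, Pi.div_apply, smul_eq_mul] at h4 ⊢
  field_simp
  rw [mul_assoc, ← h4]; ring

/-! ### The value at `i∞` as a combination of point evaluations -/

lemma valueAtInfty_eq {f : ℍ → ℂ} {c : ℂ} (h : Tendsto f atImInfty (𝓝 c)) :
    valueAtInfty f = c := h.limUnder_eq

/-- Subtracting a multiple of a power of `e₁` and dividing by `wInf` lowers the weight by two. -/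
lemma exists_eq_e1_pow_add {m : ℕ} {f : ℍ → ℂ} (hf : f ∈ forms (Gamma 2) (2 * m)) :
    ∃ g ∈ forms (Gamma 2) (2 * m - 2), f = valueAtInfty f • e1 ^ m + wInf * g := by
  have he : e1 ^ m ∈ forms (Gamma 2) (2 * m) := forms_cast (pow_mem_forms e1_mem m) (by ring)
  have hm : f - valueAtInfty f • e1 ^ m ∈ forms (Gamma 2) (2 * m) :=
    sub_mem hf (Submodule.smul_mem _ _ he)
  have ht : Tendsto (f - valueAtInfty f • e1 ^ m) atImInfty (𝓝 0) := by
    simpa using! (tendsto_of_mem_forms hf).sub ((tendsto_e1.pow m).const_smul (valueAtInfty f))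
  obtain ⟨g, hg, h⟩ := exists_wInf_mul hm (valueAtInfty_eq ht)
  exact ⟨g, hg, by rw [← h]; abel⟩

/-- Removing the value at `i∞` and dividing by `wInf` lowers the weight by two, so the dimension
grows by at most one. -/
instance finiteDimensional_forms (k : ℤ) : FiniteDimensional ℂ (forms (Gamma 2) k) := by
  have key (n : ℕ) : ∀ k : ℤ, k < n → FiniteDimensional ℂ (forms (Gamma 2) k) := by
    induction n with
    | zero =>
      intro k hk
      have : forms (Gamma 2) k = ⊥ :=
        (Submodule.eq_bot_iff _).2 fun f hf => forms_eq_zero_of_neg (by simpa using hk) hf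
      rw [this]; infer_instance
    | succ n ih =>
      intro k hk
      have := ih (k - 2) (by push_cast at hk; linarith)
      have hle : forms (Gamma 2) k ≤ Submodule.span ℂ {e1 ^ (k / 2).toNat} ⊔
          (forms (Gamma 2) (k - 2)).map (LinearMap.mulLeft ℂ wInf) := by
        intro f hf
        rcases lt_or_ge k 0 with h0 | h0
        · rw [forms_eq_zero_of_neg h0 hf]; exact zero_mem _
        rcases Int.even_or_odd' k with ⟨m, rfl | rfl⟩
        · lift m to ℕ using by linarith
          obtain ⟨g, hg, h⟩ := exists_eq_e1_pow_add hf
          rw [h, show (2 * (m : ℤ) / 2).toNat = m by simp]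
          exact Submodule.add_mem_sup
            (Submodule.smul_mem _ _ (Submodule.mem_span_singleton_self _)) ⟨g, hg, rfl⟩
        · rw [forms_eq_zero_of_odd neg_one_mem_Gamma_two ⟨m, rfl⟩ hf]; exact zero_mem _
      exact Submodule.finiteDimensional_of_le hle
  refine key (k.toNat + 1) k ?_
  have := Int.self_le_toNat k
  push_cast; linarith

/-- On the finite dimensional space of forms of level two and weight `k`, the value at `i∞` is a
linear combination of point evaluations. -/
lemma exists_valueAtInfty_eq_sum (k : ℤ) : ∃ a : ℍ →₀ ℂ, ∀ f ∈ forms (Gamma 2) k,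
    valueAtInfty f = a.sum fun z c => c * f z := by
  let W := forms (Gamma 2) k
  let L : Module.Dual ℂ W :=
    { toFun := fun f => valueAtInfty (f : ℍ → ℂ)
      map_add' := fun f g => valueAtInfty_eq
        ((tendsto_of_mem_forms f.2).add (tendsto_of_mem_forms g.2))
      map_smul' := fun c f => valueAtInfty_eq ((tendsto_of_mem_forms f.2).const_smul c) }
  let ev (z : ℍ) : Module.Dual ℂ W := (LinearMap.proj z).comp W.subtype
  have hspan : Submodule.span ℂ (Set.range ev) = ⊤ := by
    have hbot : (Submodule.span ℂ (Set.range ev)).dualCoannihilator = ⊥ := by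
      rw [Submodule.eq_bot_iff]
      intro f hf
      ext z
      exact (Submodule.mem_dualCoannihilator _).1 hf (ev z) (Submodule.subset_span ⟨z, rfl⟩)
    rw [← Subspace.dualCoannihilator_dualAnnihilator_eq (W := Submodule.span ℂ (Set.range ev)),
      hbot, Submodule.dualAnnihilator_bot]
  obtain ⟨a, ha⟩ := (Finsupp.mem_span_range_iff_exists_finsupp (v := ev) (x := L)).1
    (hspan ▸ Submodule.mem_top)
  refine ⟨a, fun f hf => ?_⟩
  have h := congrArg (fun l : Module.Dual ℂ W => l ⟨f, hf⟩) ha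
  simp only [Finsupp.sum, LinearMap.sum_apply, LinearMap.smul_apply] at h
  exact h.symm

/-! ### Functions of two variables -/

/-- All restrictions of `f` to one variable are forms of weight `k` and level two. -/
def Slices (k : ℤ) (f : ℍ × ℍ → ℂ) : Prop :=
  (∀ τ, (fun z => f (z, τ)) ∈ forms (Gamma 2) k) ∧ ∀ τ, (fun z => f (τ, z)) ∈ forms (Gamma 2) k

lemma Slices.swap {k : ℤ} {f : ℍ × ℍ → ℂ} (hf : Slices k f) : Slices k (f ∘ Prod.swap) :=
  ⟨hf.2, hf.1⟩

/-- `Φ₁ f` is a linear combination of restrictions `f (z, ·)`, hence of level two. -/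
lemma Slices.phi1_mem {k : ℤ} {f : ℍ × ℍ → ℂ} (hf : Slices k f) :
    Phi1 f ∈ forms (Gamma 2) k := by
  obtain ⟨a, ha⟩ := exists_valueAtInfty_eq_sum k
  have : Phi1 f = ∑ z ∈ a.support, a z • fun τ => f (z, τ) := by
    ext τ
    rw [show Phi1 f τ = _ from ha _ (hf.1 τ), Finsupp.sum, Finset.sum_apply]; rfl
  rw [this]
  exact Submodule.sum_mem _ fun z _ => Submodule.smul_mem _ _ (hf.2 z)

/-- The two iterated limits agree, since each is a linear combination of point evaluations. -/
lemma Slices.valueAtInfty_phi {k : ℤ} {f : ℍ × ℍ → ℂ} (hf : Slices k f) :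
    valueAtInfty (Phi1 f) = valueAtInfty (Phi2 f) := by
  obtain ⟨a, ha⟩ := exists_valueAtInfty_eq_sum k
  have h1 (τ : ℍ) : Phi1 f τ = _ := ha _ (hf.1 τ)
  have h2 (τ : ℍ) : Phi2 f τ = _ := ha _ (hf.2 τ)
  have h3 : Phi2 f ∈ forms (Gamma 2) k := hf.swap.phi1_mem
  rw [ha _ hf.phi1_mem, ha _ h3]
  simp only [h1, h2, Finsupp.sum, Finset.mul_sum]
  rw [Finset.sum_comm]
  refine Finset.sum_congr rfl fun _ _ => Finset.sum_congr rfl fun _ _ => ?_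
  ring

/-- The value of `Φ₁ f` at `i∞` is an iterated limit of `f`, which equals its own negative. -/
lemma Slices.valueAtInfty_of_antisymm {k : ℤ} {f : ℍ × ℍ → ℂ} (hf : Slices k f)
    (ha : IsAntisymm f) : valueAtInfty (Phi1 f) = 0 := by
  have h := hf.valueAtInfty_phi
  have h2 : Phi2 f = -Phi1 f := by
    ext τ
    refine Phi2_eq ?_
    refine ((tendsto_of_mem_forms (hf.1 τ)).neg).congr fun z => ?_
    rw [ha τ z]
  rw [h2, show valueAtInfty (-Phi1 f) = - valueAtInfty (Phi1 f) from
    valueAtInfty_eq (tendsto_of_mem_forms hf.phi1_mem).neg] at h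
  exact self_eq_neg.1 h

lemma mem_G_iff {M : SL(2, ℤ) × SL(2, ℤ)} : M ∈ G ↔ M.1 * M.2⁻¹ ∈ Gamma 2 := by
  rw [Gamma_mem', map_mul, map_inv, mul_inv_eq_one]; rfl

lemma IsModular.swap {k : ℕ} {f : ℍ × ℍ → ℂ} (hf : IsModular k f) :
    IsModular k (f ∘ Prod.swap) where
  holo := by
    refine hf.holo.comp (f := Prod.swap) ?_ fun p hp => ⟨hp.2, hp.1⟩
    exact (differentiable_snd.prodMk differentiable_fst).differentiableOn
  transf M hM τ₁ τ₂ := by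
    have hM' : M.swap ∈ G := (show _ = _ from hM).symm
    simp only [Function.comp_apply, Prod.swap_prod_mk]
    rw [show f (M.2 • τ₂, M.1 • τ₁) = _ from hf.transf M.swap hM' τ₂ τ₁]
    simp only [Prod.fst_swap, Prod.snd_swap]; ring
  lim1 := hf.lim2
  lim2 := hf.lim1
  mod1 := hf.mod2
  mod2 := hf.mod1

/-- Slashing a restriction of `f` amounts to moving the fixed variable, as `(γ, γ) ∈ G`. -/
lemma IsModular.slash_slice {k : ℕ} {f : ℍ × ℍ → ℂ} (hf : IsModular k f) (τ : ℍ)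
    (γ : SL(2, ℤ)) : (fun z => f (z, τ)) ∣[(k : ℤ)] γ =
      fun z => denom γ ((γ⁻¹ • τ : ℍ) : ℂ) ^ k * f (z, γ⁻¹ • τ) := by
  ext z
  have h := hf.transf (γ, γ) (mem_G_iff.2 (by simp)) z (γ⁻¹ • τ)
  have hd := denom_ne_zero γ z
  rw [ModularForm.SL_slash_apply]
  simp only [smul_inv_smul, ← denom_apply] at h
  rw [h, zpow_neg, zpow_natCast]
  field_simp

lemma IsModular.slice1 {k : ℕ} {f : ℍ × ℍ → ℂ} (hf : IsModular k f) (τ : ℍ) :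
    (fun z => f (z, τ)) ∈ forms (Gamma 2) k := by
  refine ⟨?_, fun γ hγ => ?_, fun γ => ?_⟩
  · rw [UpperHalfPlane.mdifferentiable_iff]
    have h := hf.holo.comp (f := fun z : ℂ => (z, (τ : ℂ))) (s := {z : ℂ | 0 < z.im})
      (by fun_prop) fun z hz => ⟨hz, τ.im_pos⟩
    refine h.congr fun z hz => ?_
    simp
  · ext z
    rw [ModularForm.slash_action_eq'_iff]
    have h := hf.transf (γ, 1) (mem_G_iff.2 (by simpa using hγ)) z τ
    simpa using h
  · rw [hf.slash_slice]
    exact isBoundedAtImInfty_of_tendsto ((hf.lim1 (γ⁻¹ • τ)).const_mul _)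

lemma IsModular.slices {k : ℕ} {f : ℍ × ℍ → ℂ} (hf : IsModular k f) : Slices k f :=
  ⟨hf.slice1, hf.swap.slice1⟩

lemma mem_forms_Gamma0 {k : ℤ} {f : ℍ → ℂ} (hf : f ∈ forms (Gamma 2) k) (hT : f ∣[k] T = f) :
    f ∈ forms (Gamma0 2) k := by
  refine ⟨hf.1, fun γ hγ => ?_, hf.2.2⟩
  rcases mem_Gamma_or_of_mem_Gamma0 hγ with h | h
  · exact hf.2.1 γ h
  · rw [slash_congr hf h, hT]

lemma tendsto_one_vadd : Tendsto (fun z : ℍ => (1 : ℝ) +ᵥ z) atImInfty atImInfty := by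
  rw [atImInfty, tendsto_comap_iff]
  exact tendsto_comap.congr fun z => by simp

lemma phi1_mem_Gamma0 {k : ℕ} {f : ℍ × ℍ → ℂ} (hs : Slices k f)
    (hT : ∀ z τ, f ((1 : ℝ) +ᵥ z, (1 : ℝ) +ᵥ τ) = f (z, τ)) : Phi1 f ∈ forms (Gamma0 2) k := by
  refine mem_forms_Gamma0 hs.phi1_mem ?_
  ext τ
  rw [slash_T_apply]
  refine (Phi1_eq ((tendsto_of_mem_forms (hs.1 _)).comp tendsto_one_vadd |>.congr
    fun z => hT z τ)).symm

/-- A holomorphic function with the right transformation law is modular as soon as all its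
restrictions to one variable are forms of level two. -/
lemma IsModular.of_slices {k : ℕ} {f : ℍ × ℍ → ℂ}
    (holo : DifferentiableOn ℂ (fun p : ℂ × ℂ => f (ofComplex p.1, ofComplex p.2))
      {p : ℂ × ℂ | 0 < p.1.im ∧ 0 < p.2.im})
    (transf : ∀ M ∈ G, ∀ τ₁ τ₂ : ℍ, f (M.1 • τ₁, M.2 • τ₂) =
      denom M.1 τ₁ ^ k * denom M.2 τ₂ ^ k * f (τ₁, τ₂))
    (hs : Slices k f) : IsModular k f := by
  have hT (z τ : ℍ) : f ((1 : ℝ) +ᵥ z, (1 : ℝ) +ᵥ τ) = f (z, τ) := by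
    have h := transf (T, T) (mem_G_iff.2 (by simp)) z τ
    rw [modular_T_smul, modular_T_smul] at h
    rw [h, denom_apply, denom_apply]
    simp [ModularGroup.T]
  exact
  { holo := holo
    transf := fun M hM τ₁ τ₂ => by rw [transf M hM, denom_apply, denom_apply]
    lim1 := fun τ => tendsto_of_mem_forms (hs.1 τ)
    lim2 := fun τ => tendsto_of_mem_forms (hs.2 τ)
    mod1 := mem_forms_iff.1 (phi1_mem_Gamma0 hs hT)
    mod2 := mem_forms_iff.1 (phi1_mem_Gamma0 hs.swap fun z τ => hT τ z) }

/-! ### The forms `X₂`, `X₄`, `X₈` and `Δ₆` -/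

lemma Slices.add {k : ℤ} {f g : ℍ × ℍ → ℂ} (hf : Slices k f) (hg : Slices k g) :
    Slices k (f + g) :=
  ⟨fun τ => add_mem (hf.1 τ) (hg.1 τ), fun τ => add_mem (hf.2 τ) (hg.2 τ)⟩

lemma Slices.sub {k : ℤ} {f g : ℍ × ℍ → ℂ} (hf : Slices k f) (hg : Slices k g) :
    Slices k (f - g) :=
  ⟨fun τ => sub_mem (hf.1 τ) (hg.1 τ), fun τ => sub_mem (hf.2 τ) (hg.2 τ)⟩

lemma Slices.smul {k : ℤ} (c : ℂ) {f : ℍ × ℍ → ℂ} (hf : Slices k f) : Slices k (c • f) :=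
  ⟨fun τ => Submodule.smul_mem _ c (hf.1 τ), fun τ => Submodule.smul_mem _ c (hf.2 τ)⟩

lemma Slices.mul {k l : ℤ} {f g : ℍ × ℍ → ℂ} (hf : Slices k f) (hg : Slices l g) :
    Slices (k + l) (f * g) :=
  ⟨fun τ => mul_mem_forms (hf.1 τ) (hg.1 τ), fun τ => mul_mem_forms (hf.2 τ) (hg.2 τ)⟩

lemma Slices.cast {k l : ℤ} {f : ℍ × ℍ → ℂ} (hf : Slices k f) (h : k = l) : Slices l f := h ▸ hf

lemma Slices.of_mul {k : ℤ} {a b : ℍ → ℂ} (ha : a ∈ forms (Gamma 2) k)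
    (hb : b ∈ forms (Gamma 2) k) : Slices k fun p => a p.1 * b p.2 := by
  refine ⟨fun τ => ?_, fun τ => Submodule.smul_mem _ (a τ) hb⟩
  have := Submodule.smul_mem _ (b τ) ha
  convert this using 1
  ext z; simp [mul_comm]

lemma denom_mul_SL (A B : SL(2, ℤ)) (z : ℍ) :
    denom (A * B : SL(2, ℤ)) z = denom A ((B • z : ℍ) : ℂ) * denom B z := by
  have hd := denom_ne_zero B z
  rw [denom_apply] at hd
  rw [denom_apply, denom_apply, denom_apply, coe_specialLinearGroup_apply,
    Matrix.SpecialLinearGroup.coe_mul]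
  simp only [Matrix.mul_apply, Fin.sum_univ_two]
  simp
  field_simp
  ring

/-- The transformation law for `G` follows from that for `(S, S)` and `(T, T)`, once the function
is of level two in each variable. -/
lemma transf_of_generators {k : ℕ} {f : ℍ × ℍ → ℂ} (hs : Slices k f)
    (hS : ∀ z τ : ℍ, f (S • z, S • τ) = (z : ℂ) ^ k * (τ : ℂ) ^ k * f (z, τ))
    (hT : ∀ z τ : ℍ, f ((1 : ℝ) +ᵥ z, (1 : ℝ) +ᵥ τ) = f (z, τ)) :
    ∀ M ∈ G, ∀ τ₁ τ₂ : ℍ, f (M.1 • τ₁, M.2 • τ₂) =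
      denom M.1 τ₁ ^ k * denom M.2 τ₂ ^ k * f (τ₁, τ₂) := by
  have diag (γ : SL(2, ℤ)) : ∀ τ₁ τ₂ : ℍ, f (γ • τ₁, γ • τ₂) =
      denom γ τ₁ ^ k * denom γ τ₂ ^ k * f (τ₁, τ₂) := by
    have hγ : γ ∈ Subgroup.closure {S, T} := by simp [SpecialLinearGroup.SL2Z_generators]
    induction hγ using Subgroup.closure_induction with
    | one => intro τ₁ τ₂; simp
    | mem g hg =>
      rcases hg with rfl | rfl
      · intro τ₁ τ₂; rw [hS, denom_S, denom_S]
      · intro τ₁ τ₂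
        rw [modular_T_smul, modular_T_smul, hT, denom_apply, denom_apply]
        simp [ModularGroup.T]
    | mul A B _ _ hA hB =>
      intro τ₁ τ₂
      rw [mul_smul, mul_smul, hA, hB, denom_mul_SL, denom_mul_SL]; ring
    | inv A _ hA =>
      intro τ₁ τ₂
      have h := hA (A⁻¹ • τ₁) (A⁻¹ • τ₂)
      have h1 (z : ℍ) : denom A ((A⁻¹ • z : ℍ) : ℂ) * denom (A⁻¹ : SL(2, ℤ)) z = 1 := by
        rw [← denom_mul_SL, mul_inv_cancel]; simp
      rw [smul_inv_smul, smul_inv_smul] at h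
      rw [h]
      calc f (A⁻¹ • τ₁, A⁻¹ • τ₂) = (denom A ((A⁻¹ • τ₁ : ℍ) : ℂ) * denom (A⁻¹ : SL(2, ℤ)) τ₁) ^ k *
            (denom A ((A⁻¹ • τ₂ : ℍ) : ℂ) * denom (A⁻¹ : SL(2, ℤ)) τ₂) ^ k *
            f (A⁻¹ • τ₁, A⁻¹ • τ₂) := by rw [h1, h1]; ring
        _ = _ := by ring
  intro M hM τ₁ τ₂
  have hN := mem_G_iff.1 hM
  have h := congrFun ((hs.1 (M.2 • τ₂)).2.1 _ hN) (M.2 • τ₁)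
  rw [ModularForm.slash_action_eq'_iff, ← denom_apply, zpow_natCast] at h
  rw [← mul_smul, inv_mul_cancel_right] at h
  have h2 := denom_mul_SL (M.1 * M.2⁻¹) M.2 τ₁
  rw [inv_mul_cancel_right] at h2
  rw [h, diag, h2]
  ring

lemma differentiableOn_comp_fst {g : ℍ → ℂ} (hg : MDiff g) :
    DifferentiableOn ℂ (fun p : ℂ × ℂ => g (ofComplex p.1)) {p | 0 < p.1.im ∧ 0 < p.2.im} :=
  (UpperHalfPlane.mdifferentiable_iff.1 hg).comp differentiableOn_fst fun _ hp => hp.1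

lemma differentiableOn_comp_snd {g : ℍ → ℂ} (hg : MDiff g) :
    DifferentiableOn ℂ (fun p : ℂ × ℂ => g (ofComplex p.2)) {p | 0 < p.1.im ∧ 0 < p.2.im} :=
  (UpperHalfPlane.mdifferentiable_iff.1 hg).comp differentiableOn_snd fun _ hp => hp.2

/-- Holomorphy on `ℍ × ℍ`. -/
abbrev Holo (f : ℍ × ℍ → ℂ) : Prop :=
  DifferentiableOn ℂ (fun p : ℂ × ℂ => f (ofComplex p.1, ofComplex p.2))
    {p : ℂ × ℂ | 0 < p.1.im ∧ 0 < p.2.im}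

lemma holo_mul {a b : ℍ → ℂ} (ha : MDiff a) (hb : MDiff b) :
    Holo fun p => a p.1 * b p.2 :=
  (differentiableOn_comp_fst ha).mul (differentiableOn_comp_snd hb)

lemma f11_slices : Slices 2 f11 := .of_mul e1_mem e1_mem
lemma f12_slices : Slices 2 f12 := .of_mul e1_mem e2_mem
lemma f21_slices : Slices 2 f21 := .of_mul e2_mem e1_mem
lemma f22_slices : Slices 2 f22 := .of_mul e2_mem e2_mem
lemma f11_holo : Holo f11 := holo_mul e1_mem.1 e1_mem.1
lemma f12_holo : Holo f12 := holo_mul e1_mem.1 e2_mem.1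
lemma f21_holo : Holo f21 := holo_mul e2_mem.1 e1_mem.1
lemma f22_holo : Holo f22 := holo_mul e2_mem.1 e2_mem.1

lemma X2_modular : IsModular 2 X2 := by
  have hs : Slices 2 X2 :=
    (Slices.smul _ (f11_slices.add f22_slices)).sub (Slices.smul _ (f12_slices.add f21_slices))
  refine .of_slices ?_ (transf_of_generators hs (fun z τ => ?_) fun z τ => ?_) hs
  · exact ((f11_holo.add f22_holo).const_smul (4 / 3 : ℂ)).sub
      ((f12_holo.add f21_holo).const_smul (2 / 3 : ℂ))
  · simp only [X2, f11, f12, f21, f22, Pi.sub_apply, Pi.smul_apply, Pi.add_apply, e1_S, e2_S,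
      smul_eq_mul]
    ring
  · simp only [X2, f11, f12, f21, f22, Pi.sub_apply, Pi.smul_apply, Pi.add_apply, e1_T, e2_T,
      smul_eq_mul]
    ring

lemma X4_modular : IsModular 4 X4 := by
  have h := f12_slices.sub f21_slices
  have hs : Slices 4 X4 := by
    rw [X4, sq]
    exact (Slices.smul _ (h.mul h)).cast (by norm_num)
  refine .of_slices ?_ (transf_of_generators hs (fun z τ => ?_) fun z τ => ?_) hs
  · exact ((f12_holo.sub f21_holo).pow 2).const_smul (1 / 144 : ℂ)
  · simp only [X4, f12, f21, Pi.sub_apply, Pi.smul_apply, Pi.pow_apply, e1_S, e2_S, smul_eq_mul]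
    ring
  · simp only [X4, f12, f21, Pi.sub_apply, Pi.smul_apply, Pi.pow_apply, e1_T, e2_T, smul_eq_mul]
    ring

lemma X8_modular : IsModular 8 X8 := by
  have hs : Slices 8 X8 :=
    (Slices.smul _ ((((f11_slices.sub f22_slices).mul (f12_slices.sub f21_slices)).mul
      ((f12_slices.add f21_slices).sub f11_slices)).mul
      ((f12_slices.add f21_slices).sub f22_slices))).cast (by norm_num)
  refine .of_slices ?_ (transf_of_generators hs (fun z τ => ?_) fun z τ => ?_) hs
  · exact ((((f11_holo.sub f22_holo).mul (f12_holo.sub f21_holo)).mul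
      ((f12_holo.add f21_holo).sub f11_holo)).mul
      ((f12_holo.add f21_holo).sub f22_holo)).const_smul (1 / 81 : ℂ)
  · simp only [X8, f11, f12, f21, f22, Pi.sub_apply, Pi.smul_apply, Pi.add_apply, Pi.mul_apply,
      e1_S, e2_S, smul_eq_mul]
    ring
  · simp only [X8, f11, f12, f21, f22, Pi.sub_apply, Pi.smul_apply, Pi.add_apply, Pi.mul_apply,
      e1_T, e2_T, smul_eq_mul]
    ring

lemma eta12_S (τ : ℍ) : eta12 (S • τ) = -(τ : ℂ) ^ 6 * eta12 τ := by
  have h := congrFun eta12_slash_S τ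
  have hτ := τ.ne_zero
  rw [slash_S_apply', zpow_neg, ← div_eq_mul_inv, div_eq_iff (zpow_ne_zero _ hτ)] at h
  rw [h, Pi.neg_apply, show (τ : ℂ) ^ (6 : ℤ) = (τ : ℂ) ^ 6 from rfl]; ring

lemma eta12_T (τ : ℍ) : eta12 ((1 : ℝ) +ᵥ τ) = -eta12 τ := by
  rw [← slash_T_apply eta12 6, eta12_slash_T]; rfl

lemma Delta6_eq : Delta6 = fun p => eta12 p.1 * eta12 p.2 := rfl

lemma Delta6_ne_zero (p : ℍ × ℍ) : Delta6 p ≠ 0 :=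
  mul_ne_zero (eta12_ne_zero p.1) (eta12_ne_zero p.2)

lemma Delta6_modular : IsModular 6 Delta6 := by
  have hs : Slices 6 Delta6 := .of_mul eta12_mem eta12_mem
  refine .of_slices (holo_mul mdiff_eta12 mdiff_eta12)
    (transf_of_generators hs (fun z τ => ?_) fun z τ => ?_) hs
  · simp only [Delta6_eq, eta12_S]; ring
  · simp only [Delta6_eq, eta12_T]; ring

lemma phi1_X2 : Phi1 X2 = e1 := by
  ext τ
  refine Phi1_eq ?_
  have h := (((tendsto_e1.mul_const (e1 τ)).add (tendsto_e2.mul_const (e2 τ))).const_mul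
    (4 / 3)).sub
    (((tendsto_e1.mul_const (e2 τ)).add (tendsto_e2.mul_const (e1 τ))).const_mul (2 / 3))
  convert! h using 2
  ring

lemma phi1_X4 : Phi1 X4 = (1 / 576 : ℂ) • wInf ^ 2 := by
  ext τ
  refine Phi1_eq ?_
  have h := (((tendsto_e1.mul_const (e2 τ)).sub (tendsto_e2.mul_const (e1 τ))).pow 2).const_mul
    (1 / 144)
  convert! h using 2
  simp [wInf]; ring

lemma phi1_X8 : Phi1 X8 = (1 / 1296 : ℂ) • (wInf ^ 2 * (wZero * wOne)) := by
  ext τ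
  refine Phi1_eq ?_
  have h := ((((tendsto_e1.mul_const (e1 τ)).sub (tendsto_e2.mul_const (e2 τ))).mul
    ((tendsto_e1.mul_const (e2 τ)).sub (tendsto_e2.mul_const (e1 τ)))).mul
    (((tendsto_e1.mul_const (e2 τ)).add (tendsto_e2.mul_const (e1 τ))).sub
      (tendsto_e1.mul_const (e1 τ)))).mul
    (((tendsto_e1.mul_const (e2 τ)).add (tendsto_e2.mul_const (e1 τ))).sub
      (tendsto_e2.mul_const (e2 τ))) |>.const_mul (1 / 81)
  convert! h using 2
  simp [wInf, wZero, wOne]; ring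

lemma phi1_Delta6 : Phi1 Delta6 = 0 := by
  ext τ
  refine Phi1_eq ?_
  simpa using! tendsto_eta12.mul_const (eta12 τ)

lemma X2_symm : IsSymm X2 := fun z τ => by
  simp only [X2, f11, f12, f21, f22, Pi.sub_apply, Pi.smul_apply, Pi.add_apply, smul_eq_mul]; ring

lemma X4_symm : IsSymm X4 := fun z τ => by
  simp only [X4, f12, f21, Pi.sub_apply, Pi.smul_apply, Pi.pow_apply, smul_eq_mul]; ring

lemma X8_antisymm : IsAntisymm X8 := fun z τ => by
  simp only [X8, f11, f12, f21, f22, Pi.sub_apply, Pi.smul_apply, Pi.add_apply, Pi.mul_apply,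
    smul_eq_mul]
  ring

lemma Delta6_symm : IsSymm Delta6 := fun z τ => by
  simp only [Delta6_eq]; ring

lemma IsSymm.phi2 {f : ℍ × ℍ → ℂ} (hf : IsSymm f) : Phi2 f = Phi1 f := by
  ext τ
  rw [Phi1, Phi2]; congr 1; ext z; exact hf τ z

/-- A modular form for `G` that vanishes at the boundary is divisible by `Δ₆`. -/
lemma IsModular.exists_Delta6_mul {k : ℕ} {f : ℍ × ℍ → ℂ} (hf : IsModular k f)
    (h1 : Phi1 f = 0) (h2 : Phi2 f = 0) :
    f = 0 ∨ ∃ l, k = l + 6 ∧ ∃ F, IsModular l F ∧ f = Delta6 * F := by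
  have key {f : ℍ × ℍ → ℂ} (hf : IsModular k f) (h1 : Phi1 f = 0) (τ : ℍ) :
      (fun z => f (z, τ)) / eta12 ∈ forms (Gamma 2) (k - 6) := by
    refine div_eta12_mem (hf.slice1 τ) fun γ => ?_
    rw [hf.slash_slice]
    have h := hf.lim1 (γ⁻¹ • τ)
    rw [h1] at h
    simpa using! h.const_mul (denom γ ((γ⁻¹ • τ : ℍ) : ℂ) ^ k)
  rcases lt_or_ge k 6 with hk | hk
  · left
    ext ⟨z, τ⟩
    have h := congrFun (forms_eq_zero_of_neg (by omega) (key hf h1 τ)) z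
    simpa [eta12_ne_zero] using h
  · right
    obtain ⟨l, rfl⟩ := Nat.exists_eq_add_of_le' hk
    refine ⟨l, rfl, f / Delta6, ?_, ?_⟩
    · refine .of_slices ?_ (fun M hM τ₁ τ₂ => ?_) ⟨fun τ => ?_, fun τ => ?_⟩
      · exact (hf.holo.mul (Delta6_modular.holo.inv fun p _ => Delta6_ne_zero _)).congr
          fun p _ => div_eq_mul_inv _ _
      · have hd1 := denom_ne_zero M.1 τ₁
        have hd2 := denom_ne_zero M.2 τ₂
        have hD := Delta6_ne_zero (τ₁, τ₂)
        rw [Pi.div_apply, hf.transf M hM, Delta6_modular.transf M hM, Pi.div_apply,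
          ← denom_apply, ← denom_apply]
        field_simp
        ring
      · have := Submodule.smul_mem _ (eta12 τ)⁻¹ (forms_cast (key hf h1 τ) (by push_cast; ring))
        convert this using 1
        ext z; simp [Delta6_eq]; field_simp
      · have := Submodule.smul_mem _ (eta12 τ)⁻¹
          (forms_cast (key hf.swap h2 τ) (by push_cast; ring))
        convert this using 1
        ext z; simp [Delta6_eq]; field_simp
    · ext p; simp [mul_div_cancel₀ _ (Delta6_ne_zero p)]

/-! ### Homogeneous elements of subalgebras -/

lemma hom_mul {k l : ℕ} {f g : ℍ × ℍ → ℂ} (hf : f ∈ M k) (hg : g ∈ M l) :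
    hom (k + l) (f * g) (SetLike.GradedMul.mul_mem hf hg) = hom k f hf * hom l g hg :=
  (DirectSum.of_mul_of (A := fun k => M k) ⟨f, hf⟩ ⟨g, hg⟩).symm

/-- The forms of weight `k` that lie in the subalgebra `B` of `M_*(G)`. -/
def homog (B : Subalgebra ℂ MRing) (k : ℕ) : Submodule ℂ (ℍ × ℍ → ℂ) where
  carrier := {f | ∃ hf : f ∈ M k, hom k f hf ∈ B}
  add_mem' := by
    rintro f g ⟨hf, hf'⟩ ⟨hg, hg'⟩
    refine ⟨add_mem hf hg, ?_⟩
    convert add_mem hf' hg' using 1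
    exact (map_add (DirectSum.of (fun k => M k) k) ⟨f, hf⟩ ⟨g, hg⟩)
  zero_mem' := ⟨zero_mem _, by
    convert zero_mem B using 1
    exact map_zero (DirectSum.of (fun k => M k) k)⟩
  smul_mem' := by
    rintro c f ⟨hf, hf'⟩
    refine ⟨Submodule.smul_mem _ c hf, ?_⟩
    convert B.smul_mem hf' c using 1
    exact (DirectSum.lof ℂ ℕ (fun k => M k) k).map_smul c ⟨f, hf⟩

variable {B : Subalgebra ℂ MRing}

lemma mul_mem_homog {k l : ℕ} {f g : ℍ × ℍ → ℂ} (hf : f ∈ homog B k) (hg : g ∈ homog B l) :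
    f * g ∈ homog B (k + l) := by
  obtain ⟨hf, hf'⟩ := hf
  obtain ⟨hg, hg'⟩ := hg
  exact ⟨IsModular.mul hf hg, by rw [hom_mul hf hg]; exact mul_mem hf' hg'⟩

lemma one_mem_homog : (1 : ℍ × ℍ → ℂ) ∈ homog B 0 := ⟨IsModular.one, one_mem B⟩

lemma homog_cast {k l : ℕ} {f : ℍ × ℍ → ℂ} (hf : f ∈ homog B k) (h : k = l) : f ∈ homog B l :=
  h ▸ hf

lemma pow_mem_homog {k : ℕ} {f : ℍ × ℍ → ℂ} (hf : f ∈ homog B k) (n : ℕ) :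
    f ^ n ∈ homog B (n * k) := by
  induction n with
  | zero => simpa using one_mem_homog
  | succ n ih =>
    rw [pow_succ]
    exact homog_cast (mul_mem_homog ih hf) (by ring)

/-! ### Symmetric and antisymmetric forms -/

lemma IsSymm.add {f g : ℍ × ℍ → ℂ} (hf : IsSymm f) (hg : IsSymm g) : IsSymm (f + g) :=
  fun z τ => by rw [Pi.add_apply, Pi.add_apply, hf z τ, hg z τ]

lemma IsSymm.sub {f g : ℍ × ℍ → ℂ} (hf : IsSymm f) (hg : IsSymm g) : IsSymm (f - g) :=
  fun z τ => by rw [Pi.sub_apply, Pi.sub_apply, hf z τ, hg z τ]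

lemma IsSymm.mul {f g : ℍ × ℍ → ℂ} (hf : IsSymm f) (hg : IsSymm g) : IsSymm (f * g) :=
  fun z τ => by rw [Pi.mul_apply, Pi.mul_apply, hf z τ, hg z τ]

lemma IsSymm.smul (c : ℂ) {f : ℍ × ℍ → ℂ} (hf : IsSymm f) : IsSymm (c • f) :=
  fun z τ => by rw [Pi.smul_apply, Pi.smul_apply, hf z τ]

lemma IsSymm.pow {f : ℍ × ℍ → ℂ} (hf : IsSymm f) (n : ℕ) : IsSymm (f ^ n) :=
  fun z τ => by rw [Pi.pow_apply, Pi.pow_apply, hf z τ]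

lemma IsAntisymm.sub {f g : ℍ × ℍ → ℂ} (hf : IsAntisymm f) (hg : IsAntisymm g) :
    IsAntisymm (f - g) :=
  fun z τ => by rw [Pi.sub_apply, Pi.sub_apply, hf z τ, hg z τ]; ring

lemma IsAntisymm.mul_symm {f g : ℍ × ℍ → ℂ} (hf : IsAntisymm f) (hg : IsSymm g) :
    IsAntisymm (f * g) :=
  fun z τ => by rw [Pi.mul_apply, Pi.mul_apply, hf z τ, hg z τ]; ring

lemma IsAntisymm.phi2 {f : ℍ × ℍ → ℂ} (hf : IsAntisymm f) {k : ℕ} (hm : IsModular k f) :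
    Phi2 f = -Phi1 f := by
  ext τ
  refine Phi2_eq ((hm.lim1 τ).neg.congr fun z => ?_)
  rw [hf τ z]

lemma IsModular.sub {k : ℕ} {f g : ℍ × ℍ → ℂ} (hf : IsModular k f) (hg : IsModular k g) :
    IsModular k (f - g) :=
  (M k).sub_mem hf hg

lemma Phi1_sub {k : ℕ} {f g : ℍ × ℍ → ℂ} (hf : IsModular k f) (hg : IsModular k g) :
    Phi1 (f - g) = Phi1 f - Phi1 g :=
  funext fun τ => Phi1_eq ((hf.lim1 τ).sub (hg.lim1 τ))

lemma Phi1_pow {k : ℕ} {f : ℍ × ℍ → ℂ} (hf : IsModular k f) (n : ℕ) :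
    Phi1 (f ^ n) = Phi1 f ^ n :=
  funext fun τ => Phi1_eq ((hf.lim1 τ).pow n)

lemma isModular_odd {k : ℕ} (hk : Odd k) {f : ℍ × ℍ → ℂ} (hf : IsModular k f) : f = 0 := by
  ext ⟨z, τ⟩
  exact congrFun (forms_eq_zero_of_odd neg_one_mem_Gamma_two (by exact_mod_cast hk)
    (hf.slice1 τ)) z

lemma phi1_mem {k : ℕ} {f : ℍ × ℍ → ℂ} (hf : IsModular k f) : Phi1 f ∈ forms (Gamma0 2) k :=
  mem_forms_iff.2 hf.mod1

/-! ### Forms for `Γ₀(2)` -/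

/-- A form for `Γ(2)` that changes sign under `T` vanishes at `i∞`, hence is divisible by `wInf`,
with a quotient that is invariant under `T`. -/
lemma exists_wInf_mul_of_slash_T_neg {k : ℤ} {f : ℍ → ℂ} (hf : f ∈ forms (Gamma 2) k)
    (hT : f ∣[k] T = -f) : ∃ g ∈ forms (Gamma0 2) (k - 2), f = wInf * g := by
  have h0 : valueAtInfty f = 0 := by
    have h1 := tendsto_of_mem_forms hf
    have h2 : Tendsto (f ∣[k] T) atImInfty (𝓝 (valueAtInfty f)) :=
      (h1.comp tendsto_one_vadd).congr fun τ => (slash_T_apply f k τ).symm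
    rw [hT] at h2
    exact self_eq_neg.1 (tendsto_nhds_unique h1 (by simpa using! h2.neg))
  obtain ⟨g, hg, rfl⟩ := exists_wInf_mul hf h0
  refine ⟨g, mem_forms_Gamma0 hg ?_, rfl⟩
  ext τ
  have h := congrFun hT τ
  have h1 := congrFun wInf_slash_T τ
  have h2 := wInf_ne_zero τ
  rw [slash_T_apply] at h h1 ⊢
  simp only [Pi.mul_apply, Pi.neg_apply] at h h1
  rw [h1] at h
  have h3 : wInf τ * (g ((1 : ℝ) +ᵥ τ) - g τ) = 0 := by linear_combination -h
  exact sub_eq_zero.1 ((mul_eq_zero.1 h3).resolve_left h2)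

/-- Descent for forms for `Γ₀(2)`: remove the value at `i∞` and divide by `wInf ^ 2`. -/
lemma exists_eq_e1_pow_add_sq {m : ℕ} {f : ℍ → ℂ} (hf : f ∈ forms (Gamma0 2) (2 * m)) :
    ∃ g ∈ forms (Gamma0 2) (2 * m - 4), f = valueAtInfty f • e1 ^ m + wInf ^ 2 * g := by
  obtain ⟨g, hg, h⟩ := exists_eq_e1_pow_add (forms_mono Gamma_le_Gamma0 _ hf)
  have hT : g ∣[(2 * m - 2 : ℤ)] T = -g := by
    ext τ
    have h0 := congrFun (hf.2.1 T T_mem_Gamma0) τ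
    have h1 := congrFun wInf_slash_T τ
    have h2 := wInf_ne_zero τ
    rw [slash_T_apply] at h0 h1 ⊢
    have h3 := congrFun h τ
    have h4 := congrFun h ((1 : ℝ) +ᵥ τ)
    simp only [Pi.add_apply, Pi.smul_apply, Pi.mul_apply, Pi.pow_apply, Pi.neg_apply,
      smul_eq_mul, e1_T] at h1 h3 h4 ⊢
    rw [h0, h1] at h4
    have h5 : wInf τ * (g ((1 : ℝ) +ᵥ τ) + g τ) = 0 := by linear_combination h4 - h3
    exact eq_neg_of_add_eq_zero_left ((mul_eq_zero.1 h5).resolve_left h2)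
  obtain ⟨g', hg', rfl⟩ := exists_wInf_mul_of_slash_T_neg hg hT
  exact ⟨g', forms_cast hg' (by ring), by rw [sq, mul_assoc]; exact h⟩

/-! ### Polynomials in `X₂`, `X₄`, `Δ₆` -/

/-- `Φ₁` maps `ℂ[X₂, X₄]` onto the ring of modular forms for `Γ₀(2)`. -/
lemma exists_phi1_eq (h2 : X2 ∈ homog B 2) (h4 : X4 ∈ homog B 4) (k : ℕ) :
    ∀ g ∈ forms (Gamma0 2) k, ∃ F ∈ homog B k, IsSymm F ∧ Phi1 F = g := by
  induction k using Nat.strong_induction_on with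
  | _ k ih =>
  intro g hg
  have hzero : ∃ F ∈ homog B k, IsSymm F ∧ Phi1 F = 0 :=
    ⟨0, zero_mem _, fun _ _ => rfl, Phi1_const 0⟩
  rcases Nat.even_or_odd' k with ⟨m, rfl | rfl⟩
  · obtain ⟨g', hg', h⟩ := exists_eq_e1_pow_add_sq (m := m) (by simpa using hg)
    obtain ⟨F', hF', hsymm, hphi⟩ : ∃ F' ∈ homog B (2 * m), IsSymm F' ∧
        Phi1 F' = wInf ^ 2 * g' := by
      rcases lt_or_ge (2 * m) 4 with hm | hm
      · rw [forms_eq_zero_of_neg (by omega) hg', mul_zero]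
        exact hzero
      · obtain ⟨F, hF, hs, hp⟩ := ih (2 * m - 4) (by omega) g' (forms_cast hg' (by
          rw [Nat.cast_sub hm]; push_cast; ring))
        refine ⟨(576 : ℂ) • (X4 * F), Submodule.smul_mem _ _
          (homog_cast (mul_mem_homog h4 hF) (by omega)), (X4_symm.mul hs).smul _, ?_⟩
        rw [Phi1_smul _ (X4_modular.mul hF.1), Phi1_mul X4_modular hF.1, phi1_X4, hp]
        ext τ; simp
    have hp := homog_cast (pow_mem_homog h2 m) (mul_comm m 2)
    refine ⟨valueAtInfty g • X2 ^ m + F', add_mem (Submodule.smul_mem _ _ hp) hF',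
      ((X2_symm.pow m).smul _).add hsymm, ?_⟩
    rw [Phi1_add (hp.1.smul _) hF'.1, Phi1_smul _ hp.1, Phi1_pow X2_modular, phi1_X2, hphi]
    exact h.symm
  · rw [forms_eq_zero_of_odd (Gamma_le_Gamma0 neg_one_mem_Gamma_two)
      (by exact_mod_cast odd_two_mul_add_one m) hg]
    exact hzero

/-- Every symmetric form is a polynomial in `X₂`, `X₄`, `Δ₆`: after subtracting a polynomial in
`X₂`, `X₄` with the same boundary value, it is divisible by `Δ₆`. -/
lemma symm_mem_homog (h2 : X2 ∈ homog B 2) (h4 : X4 ∈ homog B 4) (h6 : Delta6 ∈ homog B 6)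
    (k : ℕ) : ∀ f, IsModular k f → IsSymm f → f ∈ homog B k := by
  induction k using Nat.strong_induction_on with
  | _ k ih =>
  intro f hf hs
  obtain ⟨F, hF, hFs, hphi⟩ := exists_phi1_eq h2 h4 k _ (phi1_mem hf)
  have hsub := hf.sub hF.1
  have h1 : Phi1 (f - F) = 0 := by rw [Phi1_sub hf hF.1, hphi, sub_self]
  rcases hsub.exists_Delta6_mul h1 (by rw [(hs.sub hFs).phi2, h1]) with h | ⟨l, rfl, F', hF', h⟩
  · rw [sub_eq_zero.1 h]; exact hF
  · have hs' : IsSymm F' := fun z τ => by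
      have h3 := hs.sub hFs z τ
      rw [h, Pi.mul_apply, Pi.mul_apply, Delta6_symm z τ] at h3
      exact mul_left_cancel₀ (Delta6_ne_zero _) h3
    rw [← sub_add_cancel f F, h]
    exact add_mem (homog_cast (mul_mem_homog h6 (ih l (by omega) F' hF' hs')) (by omega)) hF

/-- The boundary value of an antisymmetric form vanishes at both cusps of `Γ₀(2)`. For the cusp `0`
the iterated limits are those of the slash of `f` by `(1, S)`, which is antisymmetric as well because
`(S, S) ∈ G`. -/
lemma IsAntisymm.tendsto_phi1_slash {k : ℕ} (hk : Even k) {f : ℍ × ℍ → ℂ} (hf : IsModular k f)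
    (ha : IsAntisymm f) (γ : SL(2, ℤ)) : Tendsto (Phi1 f ∣[(k : ℤ)] γ) atImInfty (𝓝 0) := by
  have hP := phi1_mem hf
  have hP2 := forms_mono Gamma_le_Gamma0 _ hP
  have hval := hf.slices.valueAtInfty_of_antisymm ha
  have hS : Tendsto (Phi1 f ∣[(k : ℤ)] S) atImInfty (𝓝 0) := by
    -- `f'` is the slash of `f` by `(1, S)`; it is again antisymmetric.
    let f' : ℍ × ℍ → ℂ := fun p => f (p.1, S • p.2) * (p.2 : ℂ) ^ (-(k : ℤ))
    have hs' : Slices k f' := by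
      refine ⟨fun τ => ?_, fun τ => ?_⟩
      · have := Submodule.smul_mem _ ((τ : ℂ) ^ (-(k : ℤ))) (hf.slice1 (S • τ))
        convert this using 1
        ext z; simp [f', mul_comm]
      · have := slash_mem_forms (hf.slices.2 τ) S
        convert this using 1
        ext z; rw [slash_S_apply']
    have ha' : IsAntisymm f' := by
      intro z τ
      have h := hf.transf (S, S) (mem_G_iff.2 (by simp)) z (S • τ)
      have hSS : S • S • τ = τ := by
        ext; rw [modular_S_smul, modular_S_smul]; simp
      have hSτ : ((S • τ : ℍ) : ℂ) = -(τ : ℂ)⁻¹ := by rw [modular_S_smul]; simp [inv_neg]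
      have hz := z.ne_zero
      have hτ := τ.ne_zero
      simp only [hSS, ← denom_apply, denom_S] at h
      rw [hSτ, hk.neg_pow, inv_pow] at h
      simp only [f']
      rw [ha τ (S • z), h, zpow_neg, zpow_neg, zpow_natCast, zpow_natCast, neg_mul, neg_neg]
      field_simp
    have hphi : Phi1 f' = Phi1 f ∣[(k : ℤ)] S := by
      ext τ
      rw [slash_S_apply']
      exact Phi1_eq ((hf.lim1 (S • τ)).mul_const _)
    have h := tendsto_of_mem_forms hs'.phi1_mem
    rwa [hs'.valueAtInfty_of_antisymm ha', hphi] at h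
  refine tendsto_slash_of_cusps hP2 ?_ hS ?_ γ
  · have h := tendsto_of_mem_forms hP2
    rwa [hval] at h
  · rwa [hP.2.1 T T_mem_Gamma0]

/-- An antisymmetric form that vanishes at the boundary is divisible by `Δ₆`. -/
lemma IsAntisymm.exists_Delta6_mul {k : ℕ} {f : ℍ × ℍ → ℂ} (hf : IsModular k f)
    (ha : IsAntisymm f) (h1 : Phi1 f = 0) :
    f = 0 ∨ ∃ l, k = l + 6 ∧ ∃ F, IsModular l F ∧ IsAntisymm F ∧ f = Delta6 * F := by
  rcases hf.exists_Delta6_mul h1 (by rw [ha.phi2 hf, h1, neg_zero]) with h | ⟨l, hl, F, hF, h⟩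
  · exact Or.inl h
  · refine Or.inr ⟨l, hl, F, hF, fun z τ => ?_, h⟩
    have h3 := ha z τ
    rw [h, Pi.mul_apply, Pi.mul_apply, Delta6_symm z τ, ← mul_neg] at h3
    exact mul_left_cancel₀ (Delta6_ne_zero _) h3

/-- Every antisymmetric form is `X₈` times a polynomial in `X₂`, `X₄`, `Δ₆`: its boundary value is
divisible by that of `X₈`, and a form with boundary value zero is divisible by `Δ₆`. -/
lemma antisymm_eq_X8_mul (h2 : X2 ∈ homog B 2) (h4 : X4 ∈ homog B 4) (h6 : Delta6 ∈ homog B 6)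
    (k : ℕ) : ∀ f, IsModular k f → IsAntisymm f →
      f = 0 ∨ ∃ l, k = l + 8 ∧ ∃ F ∈ homog B l, f = X8 * F := by
  induction k using Nat.strong_induction_on with
  | _ k ih =>
  intro f hf ha
  rcases Nat.even_or_odd k with hk | hk
  swap
  · exact Or.inl (isModular_odd hk hf)
  -- A form with boundary value zero is `Δ₆` times an antisymmetric form of lower weight.
  have descend {f : ℍ × ℍ → ℂ} (hf : IsModular k f) (ha : IsAntisymm f) (h1 : Phi1 f = 0) :
      f = 0 ∨ ∃ l, k = l + 8 ∧ ∃ F ∈ homog B l, f = X8 * F := by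
    rcases ha.exists_Delta6_mul hf h1 with h | ⟨l, rfl, F, hF, ha', h⟩
    · exact Or.inl h
    rcases ih l (by omega) F hF ha' with h0 | ⟨l, rfl, F', hF', h0⟩
    · left; rw [h, h0, mul_zero]
    · right
      refine ⟨l + 6, by omega, F' * Delta6, mul_mem_homog hF' h6, ?_⟩
      rw [h, h0]; ring
  have hP := phi1_mem hf
  have hq := div_eta12_mem (forms_mono Gamma_le_Gamma0 _ hP) (ha.tendsto_phi1_slash hk hf)
  have hqT : (Phi1 f / eta12) ∣[(k - 6 : ℤ)] T = -(Phi1 f / eta12) := by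
    rw [ModularForm.div_slash_SL2, eta12_slash_T, hP.2.1 T T_mem_Gamma0, div_neg]
  obtain ⟨g, hg, h⟩ := exists_wInf_mul_of_slash_T_neg hq hqT
  rcases lt_or_ge k 8 with hk8 | hk8
  · have hg0 := forms_eq_zero_of_neg (by omega) hg
    refine descend hf ha ?_
    ext τ
    have h3 := congrFun h τ
    simpa [hg0, eta12_ne_zero] using h3
  · obtain ⟨l, rfl⟩ := Nat.exists_eq_add_of_le' hk8
    obtain ⟨d, hd, hP⟩ := wProd_eq
    obtain ⟨F, hF, hFs, hphi⟩ := exists_phi1_eq h2 h4 l _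
      (Submodule.smul_mem _ (1296 * d⁻¹) (forms_cast hg (by push_cast; ring)))
    have hX : IsModular (l + 8) (X8 * F) := by
      rw [add_comm]; exact X8_modular.mul hF.1
    have h1 : Phi1 (f - X8 * F) = 0 := by
      rw [Phi1_sub hf hX, Phi1_mul X8_modular hF.1, phi1_X8, hphi]
      ext τ
      have h3 := congrFun h τ
      have h4 := congrFun hP τ
      simp only [Pi.sub_apply, Pi.mul_apply, Pi.div_apply, Pi.smul_apply, Pi.pow_apply,
        smul_eq_mul, Pi.zero_apply] at h3 h4 ⊢
      rw [div_eq_iff (eta12_ne_zero τ)] at h3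
      rw [h3]
      field_simp
      linear_combination -(wInf τ * g τ) * h4
    rcases descend (hf.sub hX) (ha.sub (X8_antisymm.mul_symm hFs)) h1 with
      h0 | ⟨l', hl, F', hF', h0⟩
    · exact Or.inr ⟨l, rfl, F, hF, sub_eq_zero.1 h0⟩
    · obtain rfl : l = l' := by omega
      exact Or.inr ⟨l, rfl, F' + F, add_mem hF' hF, by rw [mul_add, ← h0]; ring⟩

/-! ### Forms of level one -/

/-- The Eisenstein series of weight `4`, in terms of `e₁` and `e₂`. -/
def lvl4 (τ : ℍ) : ℂ := 4 / 3 * (e1 τ ^ 2 - e1 τ * e2 τ + e2 τ ^ 2)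

/-- The Eisenstein series of weight `6`, in terms of `e₁` and `e₂`. -/
def lvl6 (τ : ℍ) : ℂ := 4 * (e1 τ * e2 τ * (e1 τ - e2 τ))

lemma lvl4_mem : lvl4 ∈ forms ⊤ 4 := by
  refine mem_forms_top ?_ ?_ ?_
  · exact Submodule.smul_mem _ (4 / 3 : ℂ) (add_mem (sub_mem
      (forms_cast (pow_mem_forms e1_mem 2) (by norm_num))
      (forms_cast (mul_mem_forms e1_mem e2_mem) (by norm_num)))
      (forms_cast (pow_mem_forms e2_mem 2) (by norm_num)))
  · ext τ
    have hτ := τ.ne_zero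
    rw [slash_S_apply', zpow_neg, ← div_eq_mul_inv, div_eq_iff (zpow_ne_zero _ hτ),
      show (τ : ℂ) ^ (4 : ℤ) = (τ : ℂ) ^ 4 from rfl]
    simp only [lvl4, e1_S, e2_S]; ring
  · ext τ
    rw [slash_T_apply]
    simp only [lvl4, e1_T, e2_T]; ring

lemma lvl6_mem : lvl6 ∈ forms ⊤ 6 := by
  refine mem_forms_top ?_ ?_ ?_
  · exact Submodule.smul_mem _ (4 : ℂ) (forms_cast (mul_mem_forms (mul_mem_forms e1_mem e2_mem)
      (sub_mem e1_mem e2_mem)) (by norm_num))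
  · ext τ
    have hτ := τ.ne_zero
    rw [slash_S_apply', zpow_neg, ← div_eq_mul_inv, div_eq_iff (zpow_ne_zero _ hτ),
      show (τ : ℂ) ^ (6 : ℤ) = (τ : ℂ) ^ 6 from rfl]
    simp only [lvl6, e1_S, e2_S]; ring
  · ext τ
    rw [slash_T_apply]
    simp only [lvl6, e1_T, e2_T]; ring

lemma tendsto_lvl4 : Tendsto lvl4 atImInfty (𝓝 1) := by
  have := ((((tendsto_e1.pow 2).sub (tendsto_e1.mul tendsto_e2)).add (tendsto_e2.pow 2)).const_mul
    (4 / 3))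
  norm_num at this; exact this

lemma tendsto_lvl6 : Tendsto lvl6 atImInfty (𝓝 1) := by
  have := (((tendsto_e1.mul tendsto_e2).mul (tendsto_e1.sub tendsto_e2)).const_mul 4)
  norm_num at this; exact this

lemma forms_top_S {k : ℕ} {g : ℍ → ℂ} (hg : g ∈ forms ⊤ k) (τ : ℍ) :
    g (S • τ) = (τ : ℂ) ^ k * g τ := by
  have h := congrFun (hg.2.1 S (Subgroup.mem_top S)) τ
  rw [ModularForm.slash_action_eq'_iff, ← denom_apply, denom_S, zpow_natCast] at h
  exact h

lemma forms_top_dbl_S {k : ℕ} {g : ℍ → ℂ} (hg : g ∈ forms ⊤ k) (τ : ℍ) :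
    g (dbl (S • τ)) = ((τ : ℂ) / 2) ^ k * g (half τ) := by
  rw [dbl_S_smul, forms_top_S hg, coe_half]

/-- If `g` has level one, then `g (2τ)` is a form for `Γ₀(2)`. -/
lemma comp_dbl_mem {k : ℕ} {g : ℍ → ℂ} (hg : g ∈ forms ⊤ k) :
    (fun τ => g (dbl τ)) ∈ forms (Gamma0 2) k := by
  have hinv (γ : SL(2, ℤ)) (hγ : γ ∈ Gamma0 2) :
      (fun τ => g (dbl τ)) ∣[(k : ℤ)] γ = fun τ => g (dbl τ) := by
    obtain ⟨γ', -, h⟩ := exists_dbl_smul hγ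
    ext τ
    have h1 := congrFun (hg.2.1 γ' (Subgroup.mem_top γ')) (dbl τ)
    rw [ModularForm.SL_slash_apply, (h τ).2, ← (h τ).1] at h1
    rw [ModularForm.SL_slash_apply, h1]
  have hb := bounded_of_mem_forms hg
  have hS : (fun τ => g (dbl τ)) ∣[(k : ℤ)] S = (2⁻¹ ^ k : ℂ) • fun τ => g (half τ) := by
    ext τ
    have hτ := τ.ne_zero
    rw [slash_S_apply', forms_top_dbl_S hg, zpow_neg, zpow_natCast, Pi.smul_apply, smul_eq_mul,
      div_pow, inv_pow]
    field_simp
  have hSb : IsBoundedAtImInfty ((fun τ => g (dbl τ)) ∣[(k : ℤ)] S) := by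
    rw [hS]
    exact (hb.comp_tendsto tendsto_half).const_smul_left _
  refine ⟨mdiff_comp_pos_smul hg.1 _, hinv, fun γ => ?_⟩
  rcases Gamma0_two_cosets γ with h | h | h
  · rw [hinv γ h]; exact hb.comp_tendsto tendsto_dbl
  · rwa [show γ = γ * S⁻¹ * S by group, SlashAction.slash_mul, hinv _ h]
  · rw [show γ = γ * (S * T)⁻¹ * (S * T) by group, SlashAction.slash_mul, hinv _ h,
      SlashAction.slash_mul]
    exact hSb.slash k (by simp [coe_T])

lemma valueAtInfty_comp_dbl {g : ℍ → ℂ} {c : ℂ} (hg : Tendsto g atImInfty (𝓝 c)) :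
    valueAtInfty (fun τ => g (dbl τ)) = c :=
  valueAtInfty_eq (hg.comp tendsto_dbl)

lemma wInf_S (τ : ℍ) : wInf (S • τ) = -(τ : ℂ) ^ 2 * wZero τ := by
  rw [wInf, wZero, e1_S, e2_S]; ring

/-- `E₄(2τ)` as a polynomial in the generators of the forms for `Γ₀(2)`. -/
lemma lvl4_dbl (τ : ℍ) : lvl4 (dbl τ) = e1 τ ^ 2 - 1 / 12 * wInf τ ^ 2 := by
  obtain ⟨g, hg, h⟩ := exists_eq_e1_pow_add_sq (m := 2)
    (forms_cast (comp_dbl_mem (k := 4) lvl4_mem) (by norm_num))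
  obtain ⟨b, rfl⟩ := forms_zero_const (forms_cast hg (by norm_num))
  rw [valueAtInfty_comp_dbl tendsto_lvl4] at h
  -- The coefficient `b` is found by comparing the values at the cusp `0`.
  have h1 (τ : ℍ) : lvl4 (half τ) / 16 = e2 τ ^ 2 + b * wZero τ ^ 2 := by
    have h2 := congrFun h (S • τ)
    have hτ := τ.ne_zero
    simp only [Pi.add_apply, Pi.smul_apply, Pi.mul_apply, Pi.pow_apply, smul_eq_mul, e1_S, wInf_S,
      forms_top_dbl_S (k := 4) lvl4_mem] at h2
    have h3 : (τ : ℂ) ^ 4 * (lvl4 (half τ) / 16 - (e2 τ ^ 2 + b * wZero τ ^ 2)) = 0 := by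
      linear_combination h2
    exact sub_eq_zero.1 ((mul_eq_zero.1 h3).resolve_left (pow_ne_zero _ hτ))
  have h2 := tendsto_nhds_unique (((tendsto_lvl4.comp tendsto_half).div_const 16).congr h1)
    ((tendsto_e2.pow 2).add ((tendsto_wZero.pow 2).const_mul b))
  have hb : b = -1 / 12 := by linear_combination -(4 / 9) * h2
  have h3 := congrFun h τ
  simp only [Pi.add_apply, Pi.smul_apply, Pi.mul_apply, Pi.pow_apply, smul_eq_mul] at h3
  rw [h3, hb]; ring

/-- `E₆(2τ)` as a polynomial in the generators of the forms for `Γ₀(2)`. -/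
lemma lvl6_dbl (τ : ℍ) : lvl6 (dbl τ) = e1 τ ^ 3 - 1 / 8 * (e1 τ * wInf τ ^ 2) := by
  obtain ⟨g, hg, h⟩ := exists_eq_e1_pow_add_sq (m := 3)
    (forms_cast (comp_dbl_mem (k := 6) lvl6_mem) (by norm_num))
  obtain ⟨g', hg', h'⟩ := exists_eq_e1_pow_add_sq (m := 1) (forms_cast hg (by norm_num))
  rw [forms_eq_zero_of_neg (by norm_num) hg', mul_zero, add_zero] at h'
  generalize valueAtInfty g = b at h'
  subst h'
  rw [valueAtInfty_comp_dbl tendsto_lvl6] at h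
  -- The coefficient `b` is found by comparing the values at the cusp `0`.
  have h1 (τ : ℍ) : lvl6 (half τ) / 64 = -(e2 τ ^ 3 + b * (wZero τ ^ 2 * e2 τ)) := by
    have h2 := congrFun h (S • τ)
    have hτ := τ.ne_zero
    simp only [Pi.add_apply, Pi.smul_apply, Pi.mul_apply, Pi.pow_apply, smul_eq_mul, e1_S, wInf_S,
      forms_top_dbl_S (k := 6) lvl6_mem] at h2
    have h3 : (τ : ℂ) ^ 6 *
        (lvl6 (half τ) / 64 + (e2 τ ^ 3 + b * (wZero τ ^ 2 * e2 τ))) = 0 := by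
      linear_combination h2
    exact eq_neg_of_add_eq_zero_left ((mul_eq_zero.1 h3).resolve_left (pow_ne_zero _ hτ))
  have h2 := tendsto_nhds_unique (((tendsto_lvl6.comp tendsto_half).div_const 64).congr h1)
    ((tendsto_e2.pow 3).add (((tendsto_wZero.pow 2).mul tendsto_e2).const_mul b)).neg
  have hb : b = -1 / 8 := by linear_combination (8 / 9) * h2
  have h3 := congrFun h τ
  simp only [Pi.add_apply, Pi.smul_apply, Pi.mul_apply, Pi.pow_apply, smul_eq_mul] at h3
  rw [h3, hb]; ring

lemma discriminant_eq_lvl : ∃ c : ℂ, c ≠ 0 ∧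
    ∀ τ, lvl4 τ ^ 3 - lvl6 τ ^ 2 = c * ModularForm.discriminant τ := by
  obtain ⟨c, hc, h⟩ := wProd_sq
  refine ⟨16 / 27 * c, mul_ne_zero (by norm_num) hc, fun τ => ?_⟩
  have h1 := congrFun h τ
  simp only [Pi.mul_apply, Pi.smul_apply, smul_eq_mul, wInf, wZero, wOne] at h1
  rw [lvl4, lvl6]
  linear_combination (16 / 27) * h1

/-- The symmetric form `X₂² - 48 X₄`, whose boundary value is `E₄(2τ)`. -/
def g4 : ℍ × ℍ → ℂ := X2 ^ 2 - (48 : ℂ) • X4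

/-- The symmetric form `X₂³ - 72 X₂ X₄`, whose boundary value is `E₆(2τ)`. -/
def g6 : ℍ × ℍ → ℂ := X2 ^ 3 - (72 : ℂ) • (X2 * X4)

lemma g4_symm : IsSymm g4 := (X2_symm.pow 2).sub (X4_symm.smul _)

lemma g6_symm : IsSymm g6 := (X2_symm.pow 3).sub ((X2_symm.mul X4_symm).smul _)

lemma IsModular.pow {k : ℕ} {f : ℍ × ℍ → ℂ} (hf : IsModular k f) (n : ℕ) :
    IsModular (n * k) (f ^ n) :=
  (pow_mem_homog (B := ⊤) ⟨hf, Algebra.mem_top⟩ n).1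

lemma g4_modular : IsModular 4 g4 := (X2_modular.pow 2).sub (X4_modular.smul _)

lemma g6_modular : IsModular 6 g6 :=
  (X2_modular.pow 3).sub ((X2_modular.mul X4_modular).smul _)

lemma phi1_g4 (τ : ℍ) : Phi1 g4 τ = lvl4 (dbl τ) := by
  rw [g4, Phi1_sub (X2_modular.pow 2) (X4_modular.smul _), Phi1_pow X2_modular,
    Phi1_smul _ X4_modular, phi1_X2, phi1_X4, lvl4_dbl]
  simp only [Pi.sub_apply, Pi.smul_apply, Pi.pow_apply, smul_eq_mul]; ring

lemma phi1_g6 (τ : ℍ) : Phi1 g6 τ = lvl6 (dbl τ) := by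
  rw [g6, Phi1_sub (X2_modular.pow 3) ((X2_modular.mul X4_modular).smul _), Phi1_pow X2_modular,
    Phi1_smul _ (X2_modular.mul X4_modular), Phi1_mul X2_modular X4_modular, phi1_X2, phi1_X4,
    lvl6_dbl]
  simp only [Pi.sub_apply, Pi.smul_apply, Pi.pow_apply, Pi.mul_apply, smul_eq_mul]; ring

lemma phi1_X4_mul_X8 (τ : ℍ) :
    Phi1 (X4 * X8) τ = 1 / 1728 * (lvl4 (dbl τ) ^ 3 - lvl6 (dbl τ) ^ 2) := by
  rw [Phi1_mul X4_modular X8_modular, phi1_X4, phi1_X8, lvl4_dbl, lvl6_dbl]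
  simp only [Pi.smul_apply, Pi.pow_apply, Pi.mul_apply, smul_eq_mul, wInf, wZero, wOne]; ring

/-- Every form of level one is a boundary value of a polynomial in `g4`, `g6`. -/
lemma exists_phi1_half_eq (h4 : g4 ∈ homog B 4) (h6 : g6 ∈ homog B 6) (k : ℕ) :
    ∀ g ∈ forms ⊤ (k : ℤ), ∃ F ∈ homog B k, IsSymm F ∧ ∀ τ, Phi1 F (half τ) = g τ := by
  induction k using Nat.strong_induction_on with
  | _ k ih =>
  intro g hg
  have hzero : ∃ F ∈ homog B k, IsSymm F ∧ ∀ τ, Phi1 F (half τ) = 0 :=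
    ⟨0, zero_mem _, fun _ _ => rfl, fun _ => congrFun (Phi1_const 0) _⟩
  rcases Nat.even_or_odd' k with ⟨m, rfl | rfl⟩
  swap
  · rw [forms_eq_zero_of_odd (Subgroup.mem_top _) (by exact_mod_cast odd_two_mul_add_one m) hg]
    exact hzero
  by_cases hm : m = 1
  · subst hm; rw [forms_top_two hg]; exact hzero
  obtain ⟨a, b, hab⟩ : ∃ a b : ℕ, a * 4 + b * 6 = 2 * m := by
    rcases Nat.even_or_odd' m with ⟨n, rfl | rfl⟩
    · exact ⟨n, 0, by ring⟩
    · exact ⟨n - 1, 1, by omega⟩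
  have hE : lvl4 ^ a * lvl6 ^ b ∈ forms ⊤ ((2 * m : ℕ) : ℤ) :=
    forms_cast (mul_mem_forms (pow_mem_forms lvl4_mem a) (pow_mem_forms lvl6_mem b))
      (by rw [← hab]; push_cast; rfl)
  have hEt : Tendsto (lvl4 ^ a * lvl6 ^ b) atImInfty (𝓝 1) := by
    simpa using! (tendsto_lvl4.pow a).mul (tendsto_lvl6.pow b)
  have hgt := tendsto_of_mem_forms (forms_mono le_top _ hg)
  generalize valueAtInfty g = v at hgt
  have hsub : g - v • (lvl4 ^ a * lvl6 ^ b) ∈ forms ⊤ ((2 * m : ℕ) : ℤ) :=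
    sub_mem hg (Submodule.smul_mem _ _ hE)
  have hFE : g4 ^ a * g6 ^ b ∈ homog B (2 * m) :=
    homog_cast (mul_mem_homog (pow_mem_homog h4 a) (pow_mem_homog h6 b)) hab
  have hpE (τ : ℍ) : Phi1 (g4 ^ a * g6 ^ b) (half τ) = (lvl4 ^ a * lvl6 ^ b) τ := by
    rw [Phi1_mul (g4_modular.pow a) (g6_modular.pow b), Phi1_pow g4_modular, Phi1_pow g6_modular]
    simp only [Pi.mul_apply, Pi.pow_apply, phi1_g4, phi1_g6, dbl_half]
  obtain ⟨g', hg', h⟩ := exists_discriminant_mul hsub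
    (by simpa using! hgt.sub (hEt.const_smul v))
  obtain ⟨F', hF', hFs, hphi⟩ : ∃ F' ∈ homog B (2 * m), IsSymm F' ∧
      ∀ τ, Phi1 F' (half τ) = (g - v • (lvl4 ^ a * lvl6 ^ b)) τ := by
    rw [h]
    rcases lt_or_ge (2 * m) 12 with hk | hk
    · rw [forms_eq_zero_of_neg (by omega) hg', mul_zero]; exact hzero
    · obtain ⟨c, hc, hd⟩ := discriminant_eq_lvl
      obtain ⟨F, hF, hFs, hphi⟩ := ih (2 * m - 12) (by omega) g' (forms_cast hg' (by omega))
      have hD : g4 ^ 3 - g6 ^ 2 ∈ homog B 12 :=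
        sub_mem (pow_mem_homog h4 3) (pow_mem_homog h6 2)
      refine ⟨c⁻¹ • ((g4 ^ 3 - g6 ^ 2) * F), Submodule.smul_mem _ _
        (homog_cast (mul_mem_homog hD hF) (by omega)),
        (((g4_symm.pow 3).sub (g6_symm.pow 2)).mul hFs).smul _, fun τ => ?_⟩
      rw [Phi1_smul _ (hD.1.mul hF.1), Phi1_mul hD.1 hF.1,
        Phi1_sub (k := 12) (g4_modular.pow 3) (g6_modular.pow 2), Phi1_pow g4_modular,
        Phi1_pow g6_modular]
      simp only [Pi.mul_apply, Pi.pow_apply, Pi.smul_apply, Pi.sub_apply, phi1_g4, phi1_g6,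
        dbl_half, hphi, hd, smul_eq_mul]
      field_simp
  refine ⟨v • (g4 ^ a * g6 ^ b) + F', add_mem (Submodule.smul_mem _ _ hFE) hF',
    (((g4_symm.pow a).mul (g6_symm.pow b)).smul _).add hFs, fun τ => ?_⟩
  rw [Phi1_add (hFE.1.smul _) hF'.1, Phi1_smul _ hFE.1, Pi.add_apply, Pi.smul_apply, hpE, hphi]
  simp

/-! ### The spaces `A_k` -/

lemma mem_A {k : ℕ} {f : ℍ × ℍ → ℂ} (hf : IsModular k f) (h12 : Phi2 f = Phi1 f ∨ Phi2 f = -Phi1 f)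
    {g : ℍ → ℂ} (hg : g ∈ forms ⊤ k) (h : ∀ τ, Phi1 f (half τ) = g τ) : f ∈ A k := by
  obtain ⟨g', rfl⟩ := mem_forms_top_iff.1 hg
  refine ⟨hf, ⟨g', fun τ => (h τ).symm⟩, ?_⟩
  rcases h12 with h12 | h12
  · exact ⟨g', fun τ => by rw [h12, h]⟩
  · exact ⟨-g', fun τ => by rw [h12, Pi.neg_apply, h]; rfl⟩

lemma exists_of_mem_A {k : ℕ} {f : ℍ × ℍ → ℂ} (hf : f ∈ A k) :
    ∃ g ∈ forms ⊤ (k : ℤ), ∀ τ, Phi1 f (half τ) = g τ := by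
  obtain ⟨-, ⟨g, hg⟩, -⟩ := hf
  exact ⟨g, mem_forms_top_iff.2 ⟨g, rfl⟩, fun τ => (hg τ).symm⟩

lemma mem_A_of_phi1_eq_zero {k : ℕ} {f : ℍ × ℍ → ℂ} (hf : IsModular k f)
    (h12 : Phi2 f = Phi1 f ∨ Phi2 f = -Phi1 f) (h : Phi1 f = 0) : f ∈ A k :=
  mem_A hf h12 (zero_mem _) fun τ => by rw [h]; rfl

lemma swap_mem_A {k : ℕ} {f : ℍ × ℍ → ℂ} (hf : f ∈ A k) : f ∘ Prod.swap ∈ A k :=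
  ⟨hf.1.swap, hf.2.2, hf.2.1⟩

lemma phi1_eq_zero_of_half {f : ℍ × ℍ → ℂ} (h : ∀ τ, Phi1 f (half τ) = 0) : Phi1 f = 0 := by
  ext τ
  rw [← half_dbl τ, h]; rfl

lemma g4_mem_Asym : g4 ∈ Asym 4 :=
  ⟨mem_A g4_modular (.inl g4_symm.phi2) lvl4_mem fun τ => by rw [phi1_g4, dbl_half], g4_symm⟩

lemma g6_mem_Asym : g6 ∈ Asym 6 :=
  ⟨mem_A g6_modular (.inl g6_symm.phi2) lvl6_mem fun τ => by rw [phi1_g6, dbl_half], g6_symm⟩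

/-- Multiples of `Δ₆` have boundary value zero, so they satisfy the level one condition. -/
lemma mul_Delta6_mem_Asym {k : ℕ} {f : ℍ × ℍ → ℂ} (hf : IsModular k f) (hs : IsSymm f) :
    f * Delta6 ∈ Asym (k + 6) :=
  ⟨mem_A_of_phi1_eq_zero (hf.mul Delta6_modular) (.inl (hs.mul Delta6_symm).phi2)
    (by rw [Phi1_mul hf Delta6_modular, phi1_Delta6, mul_zero]), hs.mul Delta6_symm⟩

lemma Delta6_mem_Asym : Delta6 ∈ Asym 6 :=
  ⟨mem_A_of_phi1_eq_zero Delta6_modular (.inl Delta6_symm.phi2) phi1_Delta6, Delta6_symm⟩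

lemma symm_mul_X8_antisymm {f : ℍ × ℍ → ℂ} (hs : IsSymm f) : IsAntisymm (f * X8) := by
  rw [mul_comm]; exact X8_antisymm.mul_symm hs

lemma X4_mul_X8_mem_A : X4 * X8 ∈ A 12 := by
  have hm : IsModular 12 (X4 * X8) := X4_modular.mul X8_modular
  have hg : (1 / 1728 : ℂ) • (lvl4 ^ 3 - lvl6 ^ 2) ∈ forms ⊤ ((12 : ℕ) : ℤ) :=
    Submodule.smul_mem _ _ (sub_mem (forms_cast (pow_mem_forms lvl4_mem 3) (by norm_num))
      (forms_cast (pow_mem_forms lvl6_mem 2) (by norm_num)))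
  exact mem_A hm (.inr ((symm_mul_X8_antisymm X4_symm).phi2 hm)) hg fun τ => by
    rw [phi1_X4_mul_X8, dbl_half]; rfl

lemma mul_X8_mem_A {k : ℕ} {f : ℍ × ℍ → ℂ} (hf : f ∈ Asym k) (h : Phi1 f = 0) :
    f * X8 ∈ A (k + 8) := by
  have hm := hf.1.1.mul X8_modular
  exact mem_A_of_phi1_eq_zero hm (.inr ((symm_mul_X8_antisymm hf.2).phi2 hm))
    (by rw [Phi1_mul hf.1.1 X8_modular, h, zero_mul])

lemma hom_mem_gradedSub {N : ℕ → Submodule ℂ (ℍ × ℍ → ℂ)} [SetLike.GradedMonoid N] {k : ℕ}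
    {f : ℍ × ℍ → ℂ} (h : f ∈ N k) (hf : f ∈ M k) : hom k f hf ∈ gradedSub N := by
  intro l
  rw [hom, DirectSum.coe_of_apply]
  split_ifs with hkl
  · subst hkl; exact h
  · exact zero_mem _

lemma gradedSub_le {N : ℕ → Submodule ℂ (ℍ × ℍ → ℂ)} [SetLike.GradedMonoid N]
    {B : Subalgebra ℂ MRing} (h : ∀ k, ∀ f ∈ N k, f ∈ homog B k) : gradedSub N ≤ B := by
  classical
  intro x hx
  rw [← DirectSum.sum_support_of x]
  exact sum_mem fun k _ => (h k _ (hx k)).2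

/-! ### Generation of the rings -/

/-- If a subalgebra `B` contains `x² - 48 y`, `x³ - 72 x y` and `d`, as well as `c`, `x c` and `y c`,
then it contains `r c` for every `r` in `ℂ[x, y, d]`, because `1`, `x`, `y` generate `ℂ[x, y]` as a
module over `ℂ[x² - 48 y, x³ - 72 x y]`. -/
lemma mul_mem_of_mem_adjoin {R : Type*} [CommRing R] [Algebra ℂ R] {B : Subalgebra ℂ R}
    {x y d c : R} (h4 : x ^ 2 - (48 : ℂ) • y ∈ B) (h6 : x ^ 3 - (72 : ℂ) • (x * y) ∈ B)
    (hd : d ∈ B) (hc : c ∈ B) (hxc : x * c ∈ B) (hyc : y * c ∈ B) {r : R}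
    (hr : r ∈ Algebra.adjoin ℂ {x, y, d}) : r * c ∈ B := by
  -- `W r` is the condition that `r c`, `x r c`, `y r c` lie in `B`.
  -- The set of `r` with this property is stable under `x`, `y`, `d`, and it contains `1`.
  let W (r : R) : Prop := r * c ∈ B ∧ x * r * c ∈ B ∧ y * r * c ∈ B
  have key : ∀ r ∈ Algebra.adjoin ℂ {x, y, d}, ∀ s, W s → W (r * s) := by
    intro r hr
    induction hr using Algebra.adjoin_induction with
    | mem r hr =>
      rintro s ⟨h1, h2, h3⟩
      have hxx : x * (x * s) * c ∈ B := by
        have : x * (x * s) * c =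
            (x ^ 2 - (48 : ℂ) • y) * (s * c) + (48 : ℂ) • (y * s * c) := by
          simp only [Algebra.smul_def]; ring
        rw [this]
        exact add_mem (mul_mem h4 h1) (B.smul_mem h3 _)
      have hxy : x * (y * s) * c ∈ B := by
        have : x * (y * s) * c = (1 / 24 : ℂ) • ((x ^ 2 - (48 : ℂ) • y) * (x * s * c) -
            (x ^ 3 - (72 : ℂ) • (x * y)) * (s * c)) := by
          have e : (1 / 24 : ℂ) • ((24 : ℂ) • (x * (y * s) * c)) = x * (y * s) * c := by
            rw [smul_smul]; norm_num
          rw [← e]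
          congr 1
          simp only [Algebra.smul_def, map_ofNat]; ring
        rw [this]
        exact B.smul_mem (sub_mem (mul_mem h4 h2) (mul_mem h6 h1)) _
      have hyy : y * (y * s) * c ∈ B := by
        have : y * (y * s) * c = (1 / 1152 : ℂ) • ((x ^ 2 - (48 : ℂ) • y) *
            ((x ^ 2 - (48 : ℂ) • y) * (s * c)) + (24 : ℂ) • ((x ^ 2 - (48 : ℂ) • y) * (y * s * c)) -
            (x ^ 3 - (72 : ℂ) • (x * y)) * (x * s * c)) := by
          have e : (1 / 1152 : ℂ) • ((1152 : ℂ) • (y * (y * s) * c)) = y * (y * s) * c := by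
            rw [smul_smul]; norm_num
          rw [← e]
          congr 1
          simp only [Algebra.smul_def, map_ofNat]; ring
        rw [this]
        exact B.smul_mem (sub_mem (add_mem (mul_mem h4 (mul_mem h4 h1))
          (B.smul_mem (mul_mem h4 h3) _)) (mul_mem h6 h2)) _
      rcases hr with rfl | rfl | rfl
      · exact ⟨h2, hxx, by rwa [mul_left_comm]⟩
      · exact ⟨h3, hxy, hyy⟩
      · refine ⟨?_, ?_, ?_⟩
        · rw [mul_assoc]; exact mul_mem hd h1
        · rw [mul_left_comm, mul_assoc]; exact mul_mem hd h2
        · rw [mul_left_comm, mul_assoc]; exact mul_mem hd h3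
    | algebraMap a =>
      rintro s ⟨h1, h2, h3⟩
      have ha := B.algebraMap_mem a
      refine ⟨?_, ?_, ?_⟩
      · rw [mul_assoc]; exact mul_mem ha h1
      · rw [mul_left_comm, mul_assoc]; exact mul_mem ha h2
      · rw [mul_left_comm, mul_assoc]; exact mul_mem ha h3
    | add r₁ r₂ _ _ ih₁ ih₂ =>
      intro s hs
      obtain ⟨h1, h2, h3⟩ := ih₁ s hs
      obtain ⟨h1', h2', h3'⟩ := ih₂ s hs
      exact ⟨by rw [add_mul, add_mul]; exact add_mem h1 h1',
        by rw [add_mul, mul_add, add_mul]; exact add_mem h2 h2',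
        by rw [add_mul, mul_add, add_mul]; exact add_mem h3 h3'⟩
    | mul r₁ r₂ _ _ ih₁ ih₂ =>
      intro s hs
      rw [mul_assoc]
      exact ih₁ _ (ih₂ s hs)
  simpa using (key r hr 1 ⟨by simpa using hc, by simpa using hxc, by simpa using hyc⟩).1

lemma hom_g4 (h2 : X2 ∈ M 2) (h4 : X4 ∈ M 4) (h : g4 ∈ M 4) :
    hom 4 g4 h = hom 2 X2 h2 ^ 2 - (48 : ℂ) • hom 4 X4 h4 := by
  rw [sq, ← hom_mul]
  have hg : (⟨g4, h⟩ : M 4) =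
      ⟨X2 * X2, X2_modular.mul X2_modular⟩ - (48 : ℂ) • ⟨X4, h4⟩ :=
    Subtype.ext (show g4 = X2 * X2 - (48 : ℂ) • X4 by rw [g4, sq])
  rw [hom, hg, map_sub]
  congr 1
  exact (DirectSum.lof ℂ ℕ (fun k => M k) 4).map_smul 48 ⟨X4, h4⟩

lemma hom_g6 (h2 : X2 ∈ M 2) (h4 : X4 ∈ M 4) (h : g6 ∈ M 6) :
    hom 6 g6 h = hom 2 X2 h2 ^ 3 - (72 : ℂ) • (hom 2 X2 h2 * hom 4 X4 h4) := by
  rw [pow_succ, sq, ← hom_mul, ← hom_mul, ← hom_mul]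
  have hg : (⟨g6, h⟩ : M 6) =
      ⟨X2 * X2 * X2, (X2_modular.mul X2_modular).mul X2_modular⟩ -
        (72 : ℂ) • ⟨X2 * X4, X2_modular.mul X4_modular⟩ :=
    Subtype.ext (show g6 = X2 * X2 * X2 - (72 : ℂ) • (X2 * X4) by rw [g6, pow_succ, sq])
  rw [hom, hg, map_sub]
  congr 1
  exact (DirectSum.lof ℂ ℕ (fun k => M k) 6).map_smul 72 ⟨X2 * X4, X2_modular.mul X4_modular⟩

/-- The ring `ℂ[X₂, X₄, Δ₆]`. -/
def polyRing : Subalgebra ℂ MRing :=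
  Algebra.adjoin ℂ {hom 2 X2 X2_modular, hom 4 X4 X4_modular, hom 6 Delta6 Delta6_modular}

lemma X2_mem_polyRing : X2 ∈ homog polyRing 2 :=
  ⟨X2_modular, Algebra.subset_adjoin (by simp)⟩

lemma X4_mem_polyRing : X4 ∈ homog polyRing 4 :=
  ⟨X4_modular, Algebra.subset_adjoin (by simp)⟩

lemma Delta6_mem_polyRing : Delta6 ∈ homog polyRing 6 :=
  ⟨Delta6_modular, Algebra.subset_adjoin (by simp)⟩

/-- The homogeneous version of `mul_mem_of_mem_adjoin`. -/
lemma mul_mem_homog_of_polyRing (h4 : g4 ∈ homog B 4) (h6 : g6 ∈ homog B 6)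
    (hd : Delta6 ∈ homog B 6) {n : ℕ} {C : ℍ × ℍ → ℂ} (hC : C ∈ homog B n)
    (h2C : X2 * C ∈ homog B (2 + n)) (h4C : X4 * C ∈ homog B (4 + n)) {l : ℕ} {F : ℍ × ℍ → ℂ}
    (hF : F ∈ homog polyRing l) : F * C ∈ homog B (l + n) := by
  obtain ⟨_, h4⟩ := h4
  obtain ⟨_, h6⟩ := h6
  obtain ⟨_, hd⟩ := hd
  obtain ⟨hC, hC'⟩ := hC
  obtain ⟨_, h2C⟩ := h2C
  obtain ⟨_, h4C⟩ := h4C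
  obtain ⟨hF, hF'⟩ := hF
  rw [hom_g4 X2_modular X4_modular] at h4
  rw [hom_g6 X2_modular X4_modular] at h6
  rw [hom_mul X2_modular hC] at h2C
  rw [hom_mul X4_modular hC] at h4C
  refine ⟨SetLike.GradedMul.mul_mem hF hC, ?_⟩
  rw [hom_mul hF hC]
  rw [polyRing] at hF'
  exact mul_mem_of_mem_adjoin (R := MRing) h4 h6 hd hC' h2C h4C hF'

/-- The first five forms generate `A_*^sym`: after subtracting a polynomial in `g4`, `g6`, a form
in `A_k^sym` vanishes at the boundary, so it is a multiple of `Δ₆`. -/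
lemma Asym_le_homog (h4 : g4 ∈ homog B 4) (h6 : g6 ∈ homog B 6) (hd : Delta6 ∈ homog B 6)
    (h2d : X2 * Delta6 ∈ homog B 8) (h4d : X4 * Delta6 ∈ homog B 10) (k : ℕ) (f : ℍ × ℍ → ℂ)
    (hf : f ∈ Asym k) : f ∈ homog B k := by
  obtain ⟨g, hg, hfg⟩ := exists_of_mem_A hf.1
  obtain ⟨F, hF, hFs, hFg⟩ := exists_phi1_half_eq h4 h6 k g hg
  have hs : IsSymm (f - F) := IsSymm.sub hf.2 hFs
  have hm : IsModular k (f - F) := hf.1.1.sub hF.1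
  have h1 : Phi1 (f - F) = 0 := phi1_eq_zero_of_half fun τ => by
    rw [Phi1_sub hf.1.1 hF.1, Pi.sub_apply, hfg, hFg, sub_self]
  rcases hm.exists_Delta6_mul h1 (by rw [hs.phi2, h1]) with h | ⟨l, rfl, F', hF', h⟩
  · rwa [sub_eq_zero.1 h]
  · have hs' : IsSymm F' := fun z τ => by
      have h3 := hs z τ
      rw [h, Pi.mul_apply, Pi.mul_apply, Delta6_symm z τ] at h3
      exact mul_left_cancel₀ (Delta6_ne_zero _) h3
    rw [← sub_add_cancel f F, h, mul_comm]
    exact add_mem (mul_mem_homog_of_polyRing h4 h6 hd hd h2d h4d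
      (symm_mem_homog X2_mem_polyRing X4_mem_polyRing Delta6_mem_polyRing l F' hF' hs')) hF

/-- The boundary value of an antisymmetric form of level one is a cusp form, so it is the boundary
value of a multiple of `X₄ X₈`. -/
lemma exists_phi1_X4_mul_X8_mul_eq (h4 : g4 ∈ homog B 4) (h6 : g6 ∈ homog B 6) {k : ℕ}
    {f : ℍ × ℍ → ℂ} (hf : f ∈ A k) (ha : IsAntisymm f) (h48 : X4 * X8 ∈ homog B 12) :
    ∃ F ∈ homog B k, IsAntisymm F ∧ Phi1 F = Phi1 f := by
  obtain ⟨g, hg, hfg⟩ := exists_of_mem_A hf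
  have h0 : Tendsto g atImInfty (𝓝 0) := by
    have h := tendsto_of_mem_forms (forms_mono Gamma_le_Gamma0 _ (phi1_mem hf.1))
    rw [hf.1.slices.valueAtInfty_of_antisymm ha] at h
    exact (h.comp tendsto_half).congr hfg
  obtain ⟨g', hg', rfl⟩ := exists_discriminant_mul hg h0
  rcases lt_or_ge k 12 with hk | hk
  · refine ⟨0, zero_mem _, fun _ _ => by simp, ?_⟩
    rw [forms_eq_zero_of_neg (by omega) hg', mul_zero] at hfg
    rw [phi1_eq_zero_of_half hfg]
    exact Phi1_const 0
  · obtain ⟨l, rfl⟩ := Nat.exists_eq_add_of_le hk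
    obtain ⟨c, hc, hd⟩ := discriminant_eq_lvl
    obtain ⟨Q, hQ, hQs, hQg⟩ := exists_phi1_half_eq h4 h6 l g' (forms_cast hg' (by push_cast; ring))
    have hXQ := mul_mem_homog h48 hQ
    refine ⟨(1728 * c⁻¹) • (X4 * X8 * Q), Submodule.smul_mem _ _ hXQ, fun z τ => ?_, ?_⟩
    · rw [Pi.smul_apply, Pi.smul_apply, (symm_mul_X8_antisymm X4_symm).mul_symm hQs z τ, smul_neg]
    · ext τ
      rw [← half_dbl τ, hfg, Phi1_smul _ hXQ.1, Phi1_mul h48.1 hQ.1, Pi.smul_apply, Pi.mul_apply,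
        hQg, phi1_X4_mul_X8, dbl_half, hd, Pi.mul_apply, smul_eq_mul]
      field_simp

/-- The antisymmetric forms of `A_k` are generated: after subtracting a multiple of `X₄ X₈`, such a
form vanishes at the boundary, so it is `Δ₆ X₈` times a polynomial in `X₂`, `X₄`, `Δ₆`. -/
lemma antisymm_mem_homog (h4 : g4 ∈ homog B 4) (h6 : g6 ∈ homog B 6) (hd : Delta6 ∈ homog B 6)
    (h48 : X4 * X8 ∈ homog B 12) (hd8 : Delta6 * X8 ∈ homog B 14)
    (h2d8 : X2 * Delta6 * X8 ∈ homog B 16) {k : ℕ} {f : ℍ × ℍ → ℂ} (hf : f ∈ A k)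
    (ha : IsAntisymm f) : f ∈ homog B k := by
  obtain ⟨F, hF, hFa, hFg⟩ := exists_phi1_X4_mul_X8_mul_eq h4 h6 hf ha h48
  have h1 : Phi1 (f - F) = 0 := by rw [Phi1_sub hf.1 hF.1, hFg, sub_self]
  rcases (ha.sub hFa).exists_Delta6_mul (hf.1.sub hF.1) h1 with h | ⟨l, rfl, F', hF', hFa', h⟩
  · rwa [sub_eq_zero.1 h]
  rcases antisymm_eq_X8_mul X2_mem_polyRing X4_mem_polyRing Delta6_mem_polyRing l F' hF' hFa' with
    h0 | ⟨m, rfl, Q, hQ, h0⟩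
  · rw [h0, mul_zero] at h
    rwa [sub_eq_zero.1 h]
  · have h48d : X4 * (Delta6 * X8) ∈ homog B (4 + 14) := by
      rw [mul_left_comm, mul_comm]; exact homog_cast (mul_mem_homog h48 hd) rfl
    have h2d8' : X2 * (Delta6 * X8) ∈ homog B (2 + 14) := by rwa [← mul_assoc]
    rw [← sub_add_cancel f F, h, h0, show Delta6 * (X8 * Q) = Q * (Delta6 * X8) by ring]
    exact add_mem (mul_mem_homog_of_polyRing h4 h6 hd hd8 h2d8' h48d hQ) hF

/-- Every form is the sum of a symmetric and an antisymmetric form. -/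
lemma A_le_homog (hsymm : ∀ k, ∀ f ∈ Asym k, f ∈ homog B k)
    (hanti : ∀ k, ∀ f ∈ A k, IsAntisymm f → f ∈ homog B k) (k : ℕ) (f : ℍ × ℍ → ℂ)
    (hf : f ∈ A k) : f ∈ homog B k := by
  have hfs := swap_mem_A hf
  have h : f = (1 / 2 : ℂ) • (f + f ∘ Prod.swap) + (1 / 2 : ℂ) • (f - f ∘ Prod.swap) := by
    ext p
    simp only [Pi.add_apply, Pi.smul_apply, Pi.sub_apply, smul_eq_mul]; ring
  rw [h]
  refine add_mem (Submodule.smul_mem _ _ (hsymm k _ ⟨add_mem hf hfs, fun z τ => ?_⟩))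
    (Submodule.smul_mem _ _ (hanti k _ (sub_mem hf hfs) fun z τ => ?_))
  · exact add_comm _ _
  · exact (neg_sub _ _).symm

end DegHilbert

end

open DegHilbert in
theorem mainTheorem5 :
    ∃ (h2 : DegHilbert.X2 ∈ DegHilbert.M 2) (h4 : DegHilbert.X4 ∈ DegHilbert.M 4)
      (h6 : DegHilbert.Delta6 ∈ DegHilbert.M 6) (h8 : DegHilbert.X8 ∈ DegHilbert.M 8),
      let x2 : DegHilbert.MRing := DegHilbert.hom 2 DegHilbert.X2 h2
      let x4 : DegHilbert.MRing := DegHilbert.hom 4 DegHilbert.X4 h4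
      let d6 : DegHilbert.MRing := DegHilbert.hom 6 DegHilbert.Delta6 h6
      let x8 : DegHilbert.MRing := DegHilbert.hom 8 DegHilbert.X8 h8
      -- the five symmetric generators and their weights
      (DegHilbert.X2 ^ 2 - (48 : ℂ) • DegHilbert.X4 ∈ DegHilbert.Asym 4 ∧
        DegHilbert.X2 ^ 3 - (72 : ℂ) • (DegHilbert.X2 * DegHilbert.X4) ∈ DegHilbert.Asym 6 ∧
        DegHilbert.Delta6 ∈ DegHilbert.Asym 6 ∧
        DegHilbert.X2 * DegHilbert.Delta6 ∈ DegHilbert.Asym 8 ∧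
        DegHilbert.X4 * DegHilbert.Delta6 ∈ DegHilbert.Asym 10) ∧
      -- they generate the symmetric part
      Algebra.adjoin ℂ {x2 ^ 2 - (48 : ℂ) • x4, x2 ^ 3 - (72 : ℂ) • (x2 * x4),
        d6, x2 * d6, x4 * d6} = DegHilbert.AsymRing ∧
      -- the three antisymmetric generators and their weights
      ((DegHilbert.X4 * DegHilbert.X8 ∈ DegHilbert.A 12 ∧
          DegHilbert.IsAntisymm (DegHilbert.X4 * DegHilbert.X8)) ∧
        (DegHilbert.Delta6 * DegHilbert.X8 ∈ DegHilbert.A 14 ∧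
          DegHilbert.IsAntisymm (DegHilbert.Delta6 * DegHilbert.X8)) ∧
        (DegHilbert.X2 * DegHilbert.Delta6 * DegHilbert.X8 ∈ DegHilbert.A 16 ∧
          DegHilbert.IsAntisymm (DegHilbert.X2 * DegHilbert.Delta6 * DegHilbert.X8))) ∧
      -- all eight together generate the full ring
      Algebra.adjoin ℂ {x2 ^ 2 - (48 : ℂ) • x4, x2 ^ 3 - (72 : ℂ) • (x2 * x4),
        d6, x2 * d6, x4 * d6, x4 * x8, d6 * x8, x2 * d6 * x8} = DegHilbert.ARing := by
  refine ⟨X2_modular, X4_modular, Delta6_modular, X8_modular, ?_⟩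
  intro x2 x4 d6 x8
  have hX2d : X2 * Delta6 ∈ Asym 8 := mul_Delta6_mem_Asym X2_modular X2_symm
  have hX4d : X4 * Delta6 ∈ Asym 10 := mul_Delta6_mem_Asym X4_modular X4_symm
  have hdX8 : Delta6 * X8 ∈ A 14 := mul_X8_mem_A Delta6_mem_Asym phi1_Delta6
  have hX2dX8 : X2 * Delta6 * X8 ∈ A 16 := mul_X8_mem_A hX2d (by
    rw [Phi1_mul X2_modular Delta6_modular, phi1_Delta6, mul_zero])
  have eg4 : hom 4 g4 g4_modular = x2 ^ 2 - (48 : ℂ) • x4 := hom_g4 _ _ _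
  have eg6 : hom 6 g6 g6_modular = x2 ^ 3 - (72 : ℂ) • (x2 * x4) := hom_g6 _ _ _
  have e2d : hom 8 (X2 * Delta6) hX2d.1.1 = x2 * d6 := hom_mul X2_modular Delta6_modular
  have e4d : hom 10 (X4 * Delta6) hX4d.1.1 = x4 * d6 := hom_mul X4_modular Delta6_modular
  have e48 : hom 12 (X4 * X8) X4_mul_X8_mem_A.1 = x4 * x8 :=
    hom_mul X4_modular X8_modular
  have ed8 : hom 14 (Delta6 * X8) hdX8.1 = d6 * x8 := hom_mul Delta6_modular X8_modular
  have e2d8 : hom 16 (X2 * Delta6 * X8) hX2dX8.1 = x2 * d6 * x8 := by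
    rw [← e2d]; exact hom_mul hX2d.1.1 X8_modular
  refine ⟨⟨g4_mem_Asym, g6_mem_Asym, Delta6_mem_Asym, hX2d, hX4d⟩, ?_,
    ⟨⟨X4_mul_X8_mem_A, symm_mul_X8_antisymm X4_symm⟩, ⟨hdX8, symm_mul_X8_antisymm Delta6_symm⟩,
      hX2dX8, symm_mul_X8_antisymm (X2_symm.mul Delta6_symm)⟩, ?_⟩
  · rw [← eg4, ← eg6, ← e2d, ← e4d]
    refine le_antisymm (Algebra.adjoin_le ?_) (gradedSub_le (Asym_le_homog
      ⟨g4_modular, Algebra.subset_adjoin ?_⟩ ⟨g6_modular, Algebra.subset_adjoin ?_⟩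
      ⟨Delta6_modular, Algebra.subset_adjoin ?_⟩ ⟨hX2d.1.1, Algebra.subset_adjoin ?_⟩
      ⟨hX4d.1.1, Algebra.subset_adjoin ?_⟩))
    · rintro x (rfl | rfl | rfl | rfl | rfl)
      exacts [hom_mem_gradedSub g4_mem_Asym _, hom_mem_gradedSub g6_mem_Asym _,
        hom_mem_gradedSub Delta6_mem_Asym _, hom_mem_gradedSub hX2d _, hom_mem_gradedSub hX4d _]
    all_goals simp [d6]
  · rw [← eg4, ← eg6, ← e2d8, ← e2d, ← e4d, ← e48, ← ed8]
    have hle : ∀ x ∈ ({hom 4 g4 g4_modular, hom 6 g6 g6_modular, d6, hom 8 (X2 * Delta6) hX2d.1.1,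
        hom 10 (X4 * Delta6) hX4d.1.1, hom 12 (X4 * X8) X4_mul_X8_mem_A.1,
        hom 14 (Delta6 * X8) hdX8.1, hom 16 (X2 * Delta6 * X8) hX2dX8.1} : Set MRing),
        x ∈ ARing := by
      rintro x (rfl | rfl | rfl | rfl | rfl | rfl | rfl | rfl)
      exacts [hom_mem_gradedSub g4_mem_Asym.1 _, hom_mem_gradedSub g6_mem_Asym.1 _,
        hom_mem_gradedSub Delta6_mem_Asym.1 _, hom_mem_gradedSub hX2d.1 _,
        hom_mem_gradedSub hX4d.1 _, hom_mem_gradedSub X4_mul_X8_mem_A _,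
        hom_mem_gradedSub hdX8 _, hom_mem_gradedSub hX2dX8 _]
    refine le_antisymm (Algebra.adjoin_le hle) (gradedSub_le ?_)
    set B : Subalgebra ℂ MRing := Algebra.adjoin ℂ _
    have h4 : g4 ∈ homog B 4 := ⟨g4_modular, Algebra.subset_adjoin (by simp)⟩
    have h6 : g6 ∈ homog B 6 := ⟨g6_modular, Algebra.subset_adjoin (by simp)⟩
    have hd : Delta6 ∈ homog B 6 := ⟨Delta6_modular, Algebra.subset_adjoin (by simp [d6])⟩
    exact A_le_homog
      (Asym_le_homog h4 h6 hd ⟨hX2d.1.1, Algebra.subset_adjoin (by simp)⟩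
        ⟨hX4d.1.1, Algebra.subset_adjoin (by simp)⟩)
      fun _ _ => antisymm_mem_homog h4 h6 hd
        ⟨X4_mul_X8_mem_A.1, Algebra.subset_adjoin (by simp)⟩
        ⟨hdX8.1, Algebra.subset_adjoin (by simp)⟩ ⟨hX2dX8.1, Algebra.subset_adjoin (by simp)⟩
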